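/- **Theorem 3.2.** Let $d \geq 0$ be an integer and equip $\mathbb R^d$ with the Euclidean metric; write $B(x,r)$ for the closed ball with center $x$ and radius $r$. Call a set $A$ *$r$-separated* if distinct points of $A$ are at distance at least $r$. Given $0 < \beta < 1$, Alice and Bob play the following game, in which they alternate turns and Alice plays first. Alice begins by choosing a starting radius $\rho_0 > 0$; put $\rho_k = \beta^k \rho_0$. On the $k$th turn ($k = 0,1,2,\ldots$) Alice chooses a nonempty $3\rho_k$-separated set $A_k \subset \mathbb R^d$, and Bob responds by choosing a ball $B_k = B(x_k,\rho_k)$ with $x_k \in A_k$. The set $A_0$ can be any nonempty finite $3\rho_0$-separated set, and on subsequent turns Alice must ensure that $$A_{k+1} \subset B(x_k,(1-\beta)\rho_k),$$ so that $B_0 \supset B_1 \supset B_2 \supset \cdots$. The *outcome* of the game is the point $x_\infty = \lim_{k\to\infty} x_k$, and Alice's *lower* and *upper scores* are the numbers $$\liminf_{k\to\infty} \frac1k \sum_{i=0}^k \frac{\log \#(A_i)}{-\log\beta} \qquad\text{and}\qquad \limsup_{k\to\infty} \frac1k \sum_{i=0}^k \frac{\log \#(A_i)}{-\log\beta}.$$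 For $\delta \geq 0$, a set $S \subset \mathbb R^d$ is *$\delta$-dimensionally Hausdorff (resp. packing) $\beta$-winning* if Alice has a strategy which ensures, against every play of Bob, simultaneously that $x_\infty \in S$ and that her lower (resp. upper) score is at least $\delta$. It is *$\delta$-dimensionally Hausdorff (resp. packing) winning* if it is $\delta$-dimensionally Hausdorff (resp. packing) $\beta$-winning for all sufficiently small $\beta > 0$. Then for every Borel set $S \subset \mathbb R^d$, the Hausdorff dimension of $S$ is the supremum of the $\delta \geq 0$ such that $S$ is $\delta$-dimensionally Hausdorff winning, and the packing dimension of $S$ is the supremum of the $\delta \geq 0$ such that $S$ is $\delta$-dimensionally packing winning. (Here $\sup\varnothing = 0$, and the empty set has dimension $0$.) -/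

import Mathlib

open Set Filter Topology MeasureTheory
open scoped NNReal ENNReal

namespace DimensionGame

noncomputable section

/-! ### Packing measures and packing dimension -/

/-- A finite `ε`-packing of `E`: finitely many pairwise disjoint closed balls (recorded as pairs
consisting of a center and a radius) with centers in `E` and radii in `(0, ε]`. -/
structure IsPacking {X : Type*} [PseudoMetricSpace X] (ε : ℝ) (E : Set X) (P : Finset (X × ℝ)) :
    Prop where
  center_mem : ∀ p ∈ P, p.1 ∈ E
  radius_pos : ∀ p ∈ P, 0 < p.2
  radius_le : ∀ p ∈ P, p.2 ≤ ε
  pairwise_disjoint : ∀ p ∈ P, ∀ q ∈ P, p ≠ q →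
    Disjoint (Metric.closedBall p.1 p.2) (Metric.closedBall q.1 q.2)

/-- The supremum of `∑ (2 r_i) ^ s` over all `ε`-packings of `E`. Since all terms are nonnegative,
countable packings give the same supremum as finite ones. -/
def packingSup {X : Type*} [PseudoMetricSpace X] (s : ℝ≥0) (ε : ℝ) (E : Set X) : ℝ≥0∞ :=
  ⨆ (P : Finset (X × ℝ)) (_ : IsPacking ε E P), ∑ p ∈ P, ENNReal.ofReal (2 * p.2) ^ (s : ℝ)

/-- The `s`-dimensional packing premeasure: the (decreasing) limit of `packingSup s ε E` as
`ε → 0`, that is, the infimum over `ε > 0`. -/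
def packingPremeasure {X : Type*} [PseudoMetricSpace X] (s : ℝ≥0) (E : Set X) : ℝ≥0∞ :=
  ⨅ (ε : ℝ) (_ : 0 < ε), packingSup s ε E

theorem packingPremeasure_empty {X : Type*} [PseudoMetricSpace X] (s : ℝ≥0) :
    packingPremeasure s (∅ : Set X) = 0 := by
  refine le_antisymm ((iInf₂_le (1 : ℝ) one_pos).trans ?_) (zero_le)
  refine iSup₂_le fun P hP => ?_
  have h : P = ∅ := Finset.eq_empty_of_forall_notMem fun p hp => hP.center_mem p hp
  simp [h]

/-- The `s`-dimensional packing (outer) measure of `E`: the infimum of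
`∑ n, packingPremeasure s (F n)` over all countable covers `E ⊆ ⋃ n, F n`. -/
def packingMeasure {X : Type*} [PseudoMetricSpace X] (s : ℝ≥0) : OuterMeasure X :=
  OuterMeasure.ofFunction (packingPremeasure s) (packingPremeasure_empty s)

/-- The packing dimension: the supremum of the `s ≥ 0` for which the `s`-dimensional packing
measure is infinite (parallel to Mathlib's `dimH`). -/
def dimP {X : Type*} [PseudoMetricSpace X] (E : Set X) : ℝ≥0∞ :=
  ⨆ (s : ℝ≥0) (_ : packingMeasure s E = ∞), (s : ℝ≥0∞)

/-! ### The game -/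

/-- A strategy for Alice: a starting radius `ρ₀`, and for every `k` a rule producing her move
`A_k` from the centers `x_0, …, x_{k-1}` chosen by Bob so far. Her moves are finite sets: for
`A_0` this is a rule of the game, and for `k ≥ 1` it is automatic, because `A_k` has to be
separated and contained in a ball. -/
structure Strategy (E : Type*) where
  radius : ℝ
  move : (k : ℕ) → (Fin k → E) → Finset E

namespace Strategy

/-- The radius `ρ_k = β ^ k * ρ₀` of Bob's `k`-th ball. -/
def rho {E : Type*} (σ : Strategy E) (β : ℝ) (k : ℕ) : ℝ := β ^ k * σ.radius

/-- Alice's `k`-th move `A_k` when Bob's choices are `x 0, x 1, …`; it depends only on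
`x 0, …, x (k - 1)`. -/
def response {E : Type*} (σ : Strategy E) (x : ℕ → E) (k : ℕ) : Finset E :=
  σ.move k fun i => x i

/-- The strategy obeys the rules of the game with parameter `β`: `ρ₀ > 0`, and after every finite
sequence of legal choices of Bob, the next set `A_k` is nonempty, `3 ρ_k`-separated and, if
`k = j + 1`, contained in the closed ball `B(x_j, (1 - β) ρ_j)`. -/
def IsLegal {E : Type*} [PseudoMetricSpace E] (σ : Strategy E) (β : ℝ) : Prop :=
  0 < σ.radius ∧
    ∀ (x : ℕ → E) (k : ℕ), (∀ j < k, x j ∈ σ.response x j) →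
      (σ.response x k).Nonempty ∧
      (∀ a ∈ σ.response x k, ∀ b ∈ σ.response x k, a ≠ b → 3 * σ.rho β k ≤ dist a b) ∧
      (∀ j, k = j + 1 →
        ∀ a ∈ σ.response x k, a ∈ Metric.closedBall (x j) ((1 - β) * σ.rho β j))

/-- Bob plays the centers `x 0, x 1, …` legally against `σ`. -/
def IsPlay {E : Type*} (σ : Strategy E) (x : ℕ → E) : Prop :=
  ∀ k, x k ∈ σ.response x k

end Strategy

/-- `(1 / k) * ∑_{i = 0}^{k} log #(A_i) / (-log β)`. -/
def partialScore {E : Type*} (β : ℝ) (A : ℕ → Finset E) (k : ℕ) : ℝ :=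
  (1 / (k : ℝ)) * ∑ i ∈ Finset.range (k + 1), Real.log ((A i).card : ℝ) / (-Real.log β)

/-- Alice's lower score, as an extended real number. -/
def lowerScore {E : Type*} (β : ℝ) (A : ℕ → Finset E) : EReal :=
  liminf (fun k : ℕ => ((partialScore β A k : ℝ) : EReal)) atTop

/-- Alice's upper score, as an extended real number. -/
def upperScore {E : Type*} (β : ℝ) (A : ℕ → Finset E) : EReal :=
  limsup (fun k : ℕ => ((partialScore β A k : ℝ) : EReal)) atTop

/-- `S` is `δ`-dimensionally Hausdorff `β`-winning: Alice has a strategy ensuring that the outcome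
`lim x_k` lies in `S` and that her lower score is at least `δ`. -/
def HausdorffWinningWith {E : Type*} [PseudoMetricSpace E] (δ : ℝ) (β : ℝ) (S : Set E) : Prop :=
  ∃ σ : Strategy E, σ.IsLegal β ∧ ∀ x : ℕ → E, σ.IsPlay x →
    (∃ y ∈ S, Tendsto x atTop (𝓝 y)) ∧ (δ : EReal) ≤ lowerScore β (σ.response x)

/-- `S` is `δ`-dimensionally packing `β`-winning: Alice has a strategy ensuring that the outcome
`lim x_k` lies in `S` and that her upper score is at least `δ`. -/
def PackingWinningWith {E : Type*} [PseudoMetricSpace E] (δ : ℝ) (β : ℝ) (S : Set E) : Prop :=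
  ∃ σ : Strategy E, σ.IsLegal β ∧ ∀ x : ℕ → E, σ.IsPlay x →
    (∃ y ∈ S, Tendsto x atTop (𝓝 y)) ∧ (δ : EReal) ≤ upperScore β (σ.response x)

/-- `S` is `δ`-dimensionally Hausdorff winning: `β`-winning for all sufficiently small `β > 0`. -/
def HausdorffWinning {E : Type*} [PseudoMetricSpace E] (δ : ℝ) (S : Set E) : Prop :=
  ∃ β₀ ∈ Ioo (0 : ℝ) 1, ∀ β ∈ Ioo (0 : ℝ) β₀, HausdorffWinningWith δ β S

/-- `S` is `δ`-dimensionally packing winning: `β`-winning for all sufficiently small `β > 0`. -/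
def PackingWinning {E : Type*} [PseudoMetricSpace E] (δ : ℝ) (S : Set E) : Prop :=
  ∃ β₀ ∈ Ioo (0 : ℝ) 1, ∀ β ∈ Ioo (0 : ℝ) β₀, PackingWinningWith δ β S

end

end DimensionGame

/-!
A set on which Alice wins with score `δ` for one `β` has dimension at least `δ`, by following a
greedy Bob (`Strategy.exists_play_mul_cardProd_le`): if a quantity attached to the positions of
the game is superadditive, then Bob can move so that its product with the number of choices that he
has had so far never increases. In the Hausdorff case the quantity is the total weight of those sets
of a cover which still meet the set of possible outcomes; if the total weight of the cover is too
small, Bob ends at a point that is not covered (`le_dimH_of_hausdorffWinningWith`). In the packing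
case it is the packing mass of the possible outcomes, which turns out to be infinite
(`le_dimP_of_packingWinningWith`). In both cases a Baire category argument, in which Bob reaches a
position from which he cannot spoil the situation any more, provides the uniformity that is needed.

Conversely, on a Borel set of dimension greater than `δ` Alice follows a mass distribution. Her
basic move (`exists_heavy_separated`) offers `n` separated points each of which carries, on the next
scale, about the share `1 / n` of the current mass, up to a factor of order `log (1 / β)`. Hence
the number of choices that Bob has had is at least the ratio of the initial mass to the current one,
up to a factor per turn that does not affect the score in the limit `β → 0`
(`exists_forall_lossFactor_lt`). The outcome has to lie in the set itself and not just in its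
closure. To this end the set is written as a continuous image of the Baire space, and Alice controls
one more coordinate after another (`exists_tendsto_of_bounded_coordinates`).

* In the Hausdorff case the mass is the dyadic content, which is at most a constant times `ρ ^ s` on
  balls of radius `ρ`. Bounding a coordinate is cheap since the content is continuous along
  increasing sequences of arbitrary sets (`netContent_iUnion_le`), so that no Frostman measure and
  no compact subset of large dimension is required.
* In the packing case the mass is that of a fine packing. It is used until only one of its balls
  is within reach, when the score is large; then Alice fixes coordinates and passes to a much finer
  packing near the center of that ball. Such a packing exists if one discards beforehand the open
  subsets of the Baire space whose images are null (`outerMeasure_inter_support_ne_zero`).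
-/

namespace DimensionGame

/-! ### Positions of the game and their outcomes -/

namespace Strategy

variable {E : Type*}

theorem response_congr (σ : Strategy E) {x z : ℕ → E} {k : ℕ} (h : ∀ j < k, x j = z j) :
    σ.response x k = σ.response z k := by
  unfold response
  congr 1
  funext i
  exact h i i.2

/-- `x 0, …, x (k - 1)` are legal choices of Bob, so `(k, x)` is a position of the game in which
Alice is about to play `A_k`. The values `x j` with `j ≥ k` are irrelevant. -/
def IsPosition (σ : Strategy E) (k : ℕ) (x : ℕ → E) : Prop :=
  ∀ j < k, x j ∈ σ.response x j

theorem IsPosition.congr {σ : Strategy E} {k : ℕ} {x z : ℕ → E} (hx : σ.IsPosition k x)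
    (h : ∀ j < k, z j = x j) : σ.IsPosition k z := by
  intro j hj
  rw [σ.response_congr fun i hi => h i (hi.trans hj), h j hj]
  exact hx j hj

theorem IsPosition.mono {σ : Strategy E} {k l : ℕ} {x : ℕ → E} (hx : σ.IsPosition k x)
    (h : l ≤ k) : σ.IsPosition l x := fun j hj => hx j (hj.trans_le h)

theorem IsPosition.update {σ : Strategy E} {k : ℕ} {x : ℕ → E} (hx : σ.IsPosition k x) {a : E}
    (ha : a ∈ σ.response x k) : σ.IsPosition (k + 1) (Function.update x k a) := by
  have hu : ∀ j < k, Function.update x k a j = x j := fun j hj =>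
    Function.update_of_ne hj.ne _ _
  intro j hj
  rcases Nat.lt_succ_iff_lt_or_eq.mp hj with h | rfl
  · exact hx.congr hu j h
  · rw [σ.response_congr hu, Function.update_self]
    exact ha

theorem IsPlay.isPosition {σ : Strategy E} {x : ℕ → E} (hx : σ.IsPlay x) (k : ℕ) :
    σ.IsPosition k x := fun j _ => hx j

/-- The number `#(A_0) ⋯ #(A_{k-1})`. -/
noncomputable def cardProd (σ : Strategy E) (k : ℕ) (x : ℕ → E) : ℝ :=
  ∏ i ∈ Finset.range k, ((σ.response x i).card : ℝ)

theorem cardProd_succ (σ : Strategy E) (k : ℕ) (x : ℕ → E) :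
    σ.cardProd (k + 1) x = σ.cardProd k x * (σ.response x k).card :=
  Finset.prod_range_succ _ _

theorem cardProd_congr (σ : Strategy E) {k : ℕ} {x z : ℕ → E} (h : ∀ j < k, x j = z j) :
    σ.cardProd k x = σ.cardProd k z :=
  Finset.prod_congr rfl fun i hi => by
    rw [σ.response_congr fun j hj => h j (hj.trans (Finset.mem_range.mp hi))]

theorem one_le_cardProd {σ : Strategy E} {k : ℕ} {x : ℕ → E} (hx : σ.IsPosition k x) :
    1 ≤ σ.cardProd k x :=
  Finset.one_le_prod fun i hi => by
    exact_mod_cast Finset.card_pos.mpr ⟨x i, hx i (Finset.mem_range.mp hi)⟩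

theorem rho_succ (σ : Strategy E) (β : ℝ) (k : ℕ) : σ.rho β (k + 1) = β * σ.rho β k := by
  simp only [rho]; ring

theorem tendsto_rho {β : ℝ} (σ : Strategy E) (h0 : 0 < β) (h1 : β < 1) :
    Tendsto (σ.rho β) atTop (𝓝 0) := by
  have h := (tendsto_pow_atTop_nhds_zero_of_lt_one h0.le h1).mul_const σ.radius
  rwa [zero_mul] at h

/-- A score above `s` at time `k` means that Bob had more than `β ^ (-s k)` choices. -/
theorem one_lt_of_lt_partialScore {σ : Strategy E} {β : ℝ} (h0 : 0 < β) (h1 : β < 1)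
    {x : ℕ → E} (hx : σ.IsPlay x) {s : ℝ} {k : ℕ} (hk : 0 < k) (h : s < partialScore β (σ.response x) k) :
    1 < σ.cardProd (k + 1) x * β ^ (s * k) := by
  have hk' : (0 : ℝ) < k := by exact_mod_cast hk
  have hlog : 0 < -Real.log β := by linarith [Real.log_neg h0 h1]
  have hpos : 0 < σ.cardProd (k + 1) x :=
    zero_lt_one.trans_le (one_le_cardProd (hx.isPosition _))
  rw [partialScore, ← Finset.sum_div, ← Real.log_prod (fun i _ => by
    exact_mod_cast (Finset.card_pos.mpr ⟨_, hx i⟩).ne'), one_div, inv_mul_eq_div,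
    lt_div_iff₀ hk', lt_div_iff₀ hlog] at h
  change s * k * -Real.log β < Real.log (σ.cardProd (k + 1) x) at h
  rw [← Real.log_lt_log_iff one_pos (mul_pos hpos (Real.rpow_pos_of_pos h0 _)), Real.log_one,
    Real.log_mul hpos.ne' (Real.rpow_pos_of_pos h0 _).ne', Real.log_rpow h0]
  linarith

/-- A coherent sequence of ever longer finite sequences, each extending the previous one and
satisfying the next of a sequence of conditions, has a common infinite extension. -/
theorem exists_seq_of_extend (P : ℕ → ℕ → (ℕ → E) → Prop) {k₀ : ℕ} {x₀ : ℕ → E}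
    (h₀ : P 0 k₀ x₀)
    (hs : ∀ n k x, P n k x → ∃ k' > k, ∃ x', (∀ j < k, x' j = x j) ∧ P (n + 1) k' x') :
    ∃ z : ℕ → E, (∀ j < k₀, z j = x₀ j) ∧
      ∀ n, ∃ k ≥ n, ∃ x, P n k x ∧ ∀ j < k, z j = x j := by
  choose! f hf g hg hP using hs
  let s : ∀ n : ℕ, {p : ℕ × (ℕ → E) // P n p.1 p.2} := fun n =>
    Nat.rec ⟨(k₀, x₀), h₀⟩
      (fun n p => ⟨(f n p.1.1 p.1.2, g n p.1.1 p.1.2), hP n _ _ p.2⟩) n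
  let κ : ℕ → ℕ := fun n => (s n).1.1
  let y : ℕ → ℕ → E := fun n => (s n).1.2
  have hκ : ∀ n, κ n < κ (n + 1) := fun n => hf n _ _ (s n).2
  have hy : ∀ n, ∀ j < κ n, y (n + 1) j = y n j := fun n => hg n _ _ (s n).2
  have hκm : StrictMono κ := strictMono_nat_of_lt_succ hκ
  have hcoh : ∀ m n, m ≤ n → ∀ j < κ m, y n j = y m j := by
    intro m n hmn
    induction n, hmn using Nat.le_induction with
    | base => intros; rfl
    | succ n hmn ih =>
      intro j hj
      rw [hy n j (hj.trans_le (hκm.monotone hmn)), ih j hj]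
  have hz : ∀ n, ∀ j < κ n, y (j + 1) j = y n j := by
    intro n j hj
    rcases le_total n (j + 1) with h | h
    · exact hcoh _ _ h j hj
    · exact (hcoh _ _ h j ((Nat.lt_succ_self j).trans_le (hκm.id_le _))).symm
  exact ⟨fun j => y (j + 1) j, hz 0, fun n => ⟨κ n, hκm.id_le n, y n, (s n).2, hz n⟩⟩

section Metric

variable [MetricSpace E] {σ : Strategy E} {β : ℝ}

/-- The limits of the plays through the position `(k, x)`. -/
def outcomes (σ : Strategy E) (k : ℕ) (x : ℕ → E) : Set E :=
  {y | ∃ z, σ.IsPlay z ∧ (∀ j < k, z j = x j) ∧ Tendsto z atTop (𝓝 y)}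

theorem outcomes_congr (σ : Strategy E) {k : ℕ} {x z : ℕ → E} (h : ∀ j < k, x j = z j) :
    σ.outcomes k x = σ.outcomes k z := by
  ext y
  constructor
  · rintro ⟨w, hw, hwx, hy⟩
    exact ⟨w, hw, fun j hj => (hwx j hj).trans (h j hj), hy⟩
  · rintro ⟨w, hw, hwx, hy⟩
    exact ⟨w, hw, fun j hj => (hwx j hj).trans (h j hj).symm, hy⟩

theorem outcomes_subset (σ : Strategy E) {k l : ℕ} {x z : ℕ → E} (hkl : k ≤ l)
    (h : ∀ j < k, z j = x j) : σ.outcomes l z ⊆ σ.outcomes k x := by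
  rintro y ⟨w, hw, hwx, hy⟩
  exact ⟨w, hw, fun j hj => (hwx j (hj.trans_le hkl)).trans (h j hj), hy⟩

theorem outcomes_update_subset (σ : Strategy E) (k : ℕ) (x : ℕ → E) (a : E) :
    σ.outcomes (k + 1) (Function.update x k a) ⊆ σ.outcomes k x :=
  σ.outcomes_subset k.le_succ fun _ hj => Function.update_of_ne hj.ne _ _

theorem rho_pos (hσ : σ.IsLegal β) (hβ : 0 < β) (k : ℕ) : 0 < σ.rho β k :=
  mul_pos (pow_pos hβ k) hσ.1

theorem IsPosition.exists_play (hσ : σ.IsLegal β) {k : ℕ} {x : ℕ → E} (hx : σ.IsPosition k x) :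
    ∃ z, σ.IsPlay z ∧ ∀ j < k, z j = x j := by
  obtain ⟨z, hz, hP⟩ := exists_seq_of_extend (fun _ k x => σ.IsPosition k x) hx (by
    intro _ k x hx
    obtain ⟨a, ha⟩ := (hσ.2 x k hx).1
    exact ⟨k + 1, k.lt_succ_self, _, fun j hj => Function.update_of_ne hj.ne _ _, hx.update ha⟩)
  refine ⟨z, fun k => ?_, hz⟩
  obtain ⟨l, hl, y, hy, hzy⟩ := hP (k + 1)
  exact hy.congr hzy k hl

theorem IsPlay.dist_le (hσ : σ.IsLegal β) {z : ℕ → E} (hz : σ.IsPlay z) (k : ℕ) :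
    dist (z (k + 1)) (z k) ≤ (1 - β) * σ.rho β k :=
  (hσ.2 z (k + 1) (hz.isPosition _)).2.2 k rfl _ (hz (k + 1))

/-- The outcome lies in every ball `B(x_k, ρ_k)` of the play. -/
theorem IsPlay.dist_limit_le (hσ : σ.IsLegal β) (hβ : 0 < β) {z : ℕ → E} (hz : σ.IsPlay z)
    {y : E} (hy : Tendsto z atTop (𝓝 y)) (k : ℕ) : dist y (z k) ≤ σ.rho β k := by
  have key : ∀ j, k ≤ j → dist (z j) (z k) ≤ σ.rho β k - σ.rho β j := by
    intro j hj
    induction j, hj using Nat.le_induction with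
    | base => simp
    | succ j hj ih =>
      calc dist (z (j + 1)) (z k) ≤ dist (z (j + 1)) (z j) + dist (z j) (z k) :=
            dist_triangle _ _ _
        _ ≤ (1 - β) * σ.rho β j + (σ.rho β k - σ.rho β j) := add_le_add (hz.dist_le hσ j) ih
        _ = _ := by rw [rho_succ]; ring
  refine le_of_tendsto (hy.dist tendsto_const_nhds) ?_
  filter_upwards [eventually_ge_atTop k] with j hj
  linarith [key j hj, rho_pos hσ hβ j]

/-- Outcomes of plays in which Bob makes different choices in the same position are far apart. -/
theorem rho_le_dist_of_mem_outcomes (hσ : σ.IsLegal β) (hβ : 0 < β) {k : ℕ} {x : ℕ → E}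
    (hx : σ.IsPosition k x) {a b y w : E} (ha : a ∈ σ.response x k) (hb : b ∈ σ.response x k)
    (hab : a ≠ b) (hy : y ∈ σ.outcomes (k + 1) (Function.update x k a))
    (hw : w ∈ σ.outcomes (k + 1) (Function.update x k b)) : σ.rho β k ≤ dist y w := by
  obtain ⟨z, hz, hza, hzy⟩ := hy
  obtain ⟨z', hz', hzb, hzw⟩ := hw
  have h1 := hz.dist_limit_le hσ hβ hzy k
  have h2 := hz'.dist_limit_le hσ hβ hzw k
  rw [hza k k.lt_succ_self, Function.update_self] at h1
  rw [hzb k k.lt_succ_self, Function.update_self] at h2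
  have h3 := (hσ.2 x k hx).2.1 a ha b hb hab
  have h4 := dist_triangle4 a y w b
  rw [dist_comm a y] at h4
  linarith

/-- Bob's greedy strategy: if `f` is superadditive in the sense that its value in a position
bounds the sum of the values in the positions that Bob can move to, then Bob can move so that
`f` times the number of choices made available to him never increases. -/
theorem exists_play_mul_cardProd_le (hσ : σ.IsLegal β) (f : ℕ → (ℕ → E) → ℝ≥0∞)
    (hcongr : ∀ k x z, (∀ j < k, x j = z j) → f k x = f k z) {k₀ : ℕ} {x₀ : ℕ → E} {C : ℝ≥0∞}
    (hx₀ : σ.IsPosition k₀ x₀) (h₀ : f k₀ x₀ * ENNReal.ofReal (σ.cardProd k₀ x₀) ≤ C)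
    (hsub : ∀ k ≥ k₀, ∀ x, σ.IsPosition k x → (∀ j < k₀, x j = x₀ j) →
      f k x * ENNReal.ofReal (σ.cardProd k x) ≤ C →
      ∑ a ∈ σ.response x k, f (k + 1) (Function.update x k a) ≤ f k x) :
    ∃ z, σ.IsPlay z ∧ (∀ j < k₀, z j = x₀ j) ∧
      ∀ k ≥ k₀, f k z * ENNReal.ofReal (σ.cardProd k z) ≤ C := by
  let P : ℕ → ℕ → (ℕ → E) → Prop := fun n k x => k = k₀ + n ∧ σ.IsPosition k x ∧
    (∀ j < k₀, x j = x₀ j) ∧ f k x * ENNReal.ofReal (σ.cardProd k x) ≤ C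
  obtain ⟨z, hz, hP⟩ := exists_seq_of_extend P (k₀ := k₀) (x₀ := x₀)
    ⟨rfl, hx₀, fun _ _ => rfl, h₀⟩ (by
    rintro n k x ⟨hk, hx, hxx₀, hC⟩
    obtain ⟨a, ha, hmin⟩ := Finset.exists_min_image (σ.response x k)
      (fun a => f (k + 1) (Function.update x k a)) (hσ.2 x k hx).1
    have hu : ∀ j < k, Function.update x k a j = x j :=
      fun j hj => Function.update_of_ne hj.ne _ _
    refine ⟨k + 1, k.lt_succ_self, Function.update x k a, hu, by omega, hx.update ha, ?_, ?_⟩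
    · intro j hj
      rw [hu j (by omega), hxx₀ j hj]
    · have h1 : (σ.response x k).card • f (k + 1) (Function.update x k a) ≤ f k x :=
        (Finset.card_nsmul_le_sum _ _ _ hmin).trans (hsub k (by omega) x hx hxx₀ hC)
      have h2 : 0 ≤ σ.cardProd k x := zero_le_one.trans (one_le_cardProd hx)
      rw [cardProd_succ, σ.cardProd_congr hu, σ.response_congr hu, ENNReal.ofReal_mul h2,
        ENNReal.ofReal_natCast]
      calc _ = (σ.response x k).card • f (k + 1) (Function.update x k a) *
            ENNReal.ofReal (σ.cardProd k x) := by rw [nsmul_eq_mul]; ring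
        _ ≤ _ := by gcongr
        _ ≤ C := hC)
  refine ⟨z, fun k => ?_, hz, fun k hk => ?_⟩
  · obtain ⟨l, hl, y, hy, hzy⟩ := hP (k + 1)
    exact hy.2.1.congr hzy k hl
  · obtain ⟨l, -, y, ⟨hl, -, -, hC⟩, hzy⟩ := hP (k - k₀)
    obtain rfl : k = l := by omega
    rwa [hcongr k z y hzy, σ.cardProd_congr hzy]

end Metric

end Strategy

/-! ### A Hausdorff winning set has large Hausdorff dimension -/

/-- A `μH[s]`-null set has countable covers of arbitrarily small total weight. The weights `w n`
are positive even if some of the sets `t n` have diameter zero. -/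
theorem exists_cover_of_hausdorffMeasure_eq_zero {E : Type*} [MetricSpace E] [MeasurableSpace E]
    [BorelSpace E] {S : Set E} {s : ℝ} (hs : 0 < s) (h : μH[s] S = 0) {ε : ℝ≥0∞} (hε : ε ≠ 0) :
    ∃ (t : ℕ → Set E) (w : ℕ → ℝ≥0∞), S ⊆ ⋃ n, t n ∧ (∀ n, 0 < w n) ∧
      (∀ n, Metric.ediam (t n) ^ s ≤ w n) ∧ ∑' n, w n < ε := by
  rw [Measure.hausdorffMeasure_apply, ← ENNReal.bot_eq_zero, iSup₂_eq_bot] at h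
  have h1 := h 1 one_pos
  rw [ENNReal.bot_eq_zero] at h1
  have h2 := (h1.trans_lt (ENNReal.half_pos hε).bot_lt)
  simp only [iInf_lt_iff] at h2
  obtain ⟨t, hcov, -, hsum⟩ := h2
  obtain ⟨e, he, hesum⟩ := ENNReal.exists_pos_sum_of_countable' (ENNReal.half_pos hε).ne' ℕ
  refine ⟨t, fun n => Metric.ediam (t n) ^ s + e n, hcov,
    fun n => (he n).trans_le le_add_self, fun n => le_self_add, ?_⟩
  rw [ENNReal.tsum_add, ← ENNReal.add_halves ε]
  refine ENNReal.add_lt_add (lt_of_le_of_lt (ENNReal.tsum_le_tsum fun n => ?_) hsum) hesum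
  rcases (t n).eq_empty_or_nonempty with h0 | h0
  · simp [h0, hs]
  · exact le_iSup_of_le h0 le_rfl

open Strategy in
/-- A set that is `δ`-dimensionally Hausdorff `β`-winning for a single `β` has dimension at least
`δ`. If the set were `μH[s]`-null for some `s < δ`, Bob could choose a cover of small total weight
and move greedily so as to keep the weight of those covering sets that are still within reach below
the reciprocal of the number of choices he has had, and hence avoid them all. -/
theorem le_dimH_of_hausdorffWinningWith {E : Type*} [MetricSpace E] [Nonempty E] {S : Set E}
    {δ : ℝ≥0} {β : ℝ} (hβ : β ∈ Ioo (0 : ℝ) 1) (h : HausdorffWinningWith δ β S) :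
    (δ : ℝ≥0∞) ≤ dimH S := by
  borelize E
  obtain ⟨h0, h1⟩ := hβ
  obtain ⟨σ, hσ, hwin⟩ := h
  refine ENNReal.le_of_forall_nnreal_lt fun s hs => ?_
  rcases eq_or_lt_of_le (zero_le (a := s)) with rfl | hs0
  · simp
  have hs0' : (0 : ℝ) < s := hs0
  have hsδ : (s : ℝ) < δ := by exact_mod_cast hs
  refine le_dimH_of_hausdorffMeasure_ne_zero fun hnull => ?_
  -- Bob can reach a position after which `#(A_0) ⋯ #(A_k) > β ^ (-s k)` for all `k`: otherwise he
  -- could violate this infinitely often.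
  obtain ⟨k₀, x₀, hx₀, hgood⟩ : ∃ k₀ x₀, σ.IsPosition k₀ x₀ ∧ ∀ z, σ.IsPlay z →
      (∀ j < k₀, z j = x₀ j) → ∀ k ≥ k₀, 1 < σ.cardProd (k + 1) z * β ^ (s * k : ℝ) := by
    by_contra! hcon
    let P : ℕ → ℕ → (ℕ → E) → Prop := fun n k x => σ.IsPosition k x ∧ n ≤ k ∧
      (n = 0 ∨ ∃ l, n ≤ l + 1 ∧ l + 1 ≤ k ∧ σ.cardProd (l + 1) x * β ^ (s * l : ℝ) ≤ 1)
    obtain ⟨z, -, hz⟩ := exists_seq_of_extend P (k₀ := 0) (x₀ := fun _ => Classical.arbitrary E)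
      ⟨fun j hj => absurd hj (Nat.not_lt_zero j), le_rfl, Or.inl rfl⟩ (by
        rintro n k x ⟨hx, hnk, -⟩
        obtain ⟨z, hz, hzx, l, hl, hbad⟩ := hcon k x hx
        exact ⟨l + 1, by omega, z, hzx, hz.isPosition _, by omega,
          Or.inr ⟨l, by omega, le_rfl, hbad⟩⟩)
    have hplay : σ.IsPlay z := by
      intro k
      obtain ⟨l, hl, y, hy, hzy⟩ := hz (k + 1)
      exact hy.1.congr hzy k hl
    have hscore : ((s : ℝ) : EReal) < lowerScore β (σ.response z) :=
      lt_of_lt_of_le (by exact_mod_cast hsδ) (hwin z hplay).2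
    obtain ⟨N, hN⟩ := eventually_atTop.mp (eventually_lt_of_lt_liminf hscore)
    obtain ⟨k, hk, y, ⟨-, -, hy⟩, hzy⟩ := hz (N + 2)
    rcases hy with hy | ⟨l, hl, hlk, hbad⟩
    · omega
    · rw [← σ.cardProd_congr fun j hj => hzy j (by omega)] at hbad
      exact hbad.not_gt (one_lt_of_lt_partialScore h0 h1 hplay (by omega)
        (by exact_mod_cast hN l (by omega)))
  -- Replacing `x₀` by a play through it, the position can be moved to a later turn.
  obtain ⟨z₀, hz₀, hzx₀⟩ := hx₀.exists_play hσ
  -- As long as the weight within reach times `cardProd` stays below `κ`, every set of the cover that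
  -- is within reach at turn `k` has diameter less than `ρ_k`.
  set κ : ℝ := (σ.radius * β) ^ (s : ℝ) with hκ
  have hκ0 : 0 < κ := Real.rpow_pos_of_pos (mul_pos hσ.1 h0) _
  have hQ0 : ∀ {k x}, σ.IsPosition k x → 0 < σ.cardProd k x := fun hx =>
    zero_lt_one.trans_le (one_le_cardProd hx)
  have hκρ : ∀ k ≥ k₀ + 1, ∀ x, σ.IsPosition k x → (∀ j < k₀ + 1, x j = z₀ j) →
      κ ≤ σ.rho β k ^ (s : ℝ) * σ.cardProd k x := by
    intro k hk x hx hxz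
    obtain ⟨z, hz, hzx⟩ := hx.exists_play hσ
    obtain ⟨l, rfl⟩ : ∃ l, k = l + 1 := ⟨k - 1, by omega⟩
    have hg := hgood z hz (fun j hj => by
      rw [hzx j (by omega), hxz j (by omega), hzx₀ j hj]) l (by omega)
    rw [σ.cardProd_congr hzx] at hg
    have : σ.rho β (l + 1) ^ (s : ℝ) = κ * β ^ (s * l : ℝ) := by
      rw [hκ, mul_comm (s : ℝ), Real.rpow_mul h0.le, Real.rpow_natCast,
        ← Real.mul_rpow (mul_pos hσ.1 h0).le (pow_pos h0 l).le, Strategy.rho]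
      ring_nf
    rw [this]
    nlinarith
  set Q₀ := ENNReal.ofReal (σ.cardProd (k₀ + 1) z₀) with hQ₀
  obtain ⟨t, w, hcov, hw0, htw, hsum⟩ := exists_cover_of_hausdorffMeasure_eq_zero hs0' hnull
    (ε := ENNReal.ofReal κ / Q₀) (ENNReal.div_pos (by simpa using hκ0) (by simp [hQ₀])).ne'
  -- the total weight of the covering sets that Bob may still run into
  classical
  let f : ℕ → (ℕ → E) → ℝ≥0∞ := fun k x =>
    ∑' n, if (t n ∩ σ.outcomes k x).Nonempty then w n else 0
  have hwf : ∀ n k x, (t n ∩ σ.outcomes k x).Nonempty → w n ≤ f k x := fun n k x hn =>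
    le_trans (by simp [hn]) (ENNReal.le_tsum n)
  have hf0 : f (k₀ + 1) z₀ * Q₀ < ENNReal.ofReal κ := by
    refine (ENNReal.lt_div_iff_mul_lt (Or.inl ?_) (Or.inl (by simp [hQ₀]))).mp
      (lt_of_le_of_lt (ENNReal.tsum_le_tsum fun n => ?_) hsum)
    · simpa [hQ₀] using hQ0 (hz₀.isPosition _)
    · split_ifs <;> simp
  have hlt : ∀ {k x}, k ≥ k₀ + 1 → σ.IsPosition k x → (∀ j < k₀ + 1, x j = z₀ j) →
      f k x * ENNReal.ofReal (σ.cardProd k x) ≤ f (k₀ + 1) z₀ * Q₀ →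
      f k x < ENNReal.ofReal (σ.rho β k) ^ (s : ℝ) := by
    intro k x hk hx hxz hC
    have h2 := (hC.trans_lt hf0).trans_le (ENNReal.ofReal_le_ofReal (hκρ k hk x hx hxz))
    rw [ENNReal.ofReal_mul (Real.rpow_nonneg (rho_pos hσ h0 k).le _),
      ← ENNReal.ofReal_rpow_of_pos (rho_pos hσ h0 k)] at h2
    exact lt_of_mul_lt_mul_right' h2
  obtain ⟨z, hz, hzz, hzC⟩ := exists_play_mul_cardProd_le hσ f
    (fun k x z h => by simp only [f, σ.outcomes_congr h]) (hz₀.isPosition (k₀ + 1)) le_rfl (by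
    intro k hk x hx hxz hC
    have hfk := hlt hk hx hxz hC
    simp only [f]
    rw [← Summable.tsum_finsetSum (fun _ _ => ENNReal.summable)]
    refine ENNReal.tsum_le_tsum fun n => ?_
    by_cases hn : ∃ a ∈ σ.response x k,
        (t n ∩ σ.outcomes (k + 1) (Function.update x k a)).Nonempty
    · obtain ⟨a, ha, y, hyt, hy⟩ := hn
      have hnx : (t n ∩ σ.outcomes k x).Nonempty :=
        ⟨y, hyt, σ.outcomes_update_subset k x a hy⟩
      -- `t n` is so small that it meets the outcomes of only one of the moves
      have hdiam : Metric.ediam (t n) < ENNReal.ofReal (σ.rho β k) :=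
        (ENNReal.rpow_lt_rpow_iff hs0').mp
          (((htw n).trans (hwf n k x hnx)).trans_lt hfk)
      rw [Finset.sum_eq_single_of_mem a ha, if_pos hnx]
      · split_ifs <;> simp
      · intro b hb hba
        refine if_neg ?_
        rintro ⟨y', hyt', hy'⟩
        have h3 := rho_le_dist_of_mem_outcomes hσ h0 hx hb ha hba hy' hy
        have h4 := (Metric.edist_le_ediam_of_mem hyt' hyt).trans_lt hdiam
        rw [edist_dist] at h4
        exact h3.not_gt ((ENNReal.ofReal_lt_ofReal_iff (rho_pos hσ h0 k)).mp h4)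
    · push Not at hn
      rw [Finset.sum_eq_zero fun a ha => if_neg (by simp [hn a ha])]
      exact zero_le)
  obtain ⟨y, hyS, hy⟩ := (hwin z hz).1
  obtain ⟨n, hn⟩ := mem_iUnion.mp (hcov hyS)
  have hle : ∀ k ≥ k₀ + 1, w n ≤ ENNReal.ofReal (σ.rho β k) ^ (s : ℝ) := fun k hk =>
    (hwf n k z ⟨y, hn, z, hz, fun _ _ => rfl, hy⟩).trans
      (hlt hk (hz.isPosition k) hzz (hzC k hk)).le
  have hlim : Tendsto (fun k => ENNReal.ofReal (σ.rho β k) ^ (s : ℝ)) atTop (𝓝 0) := by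
    have := (ENNReal.tendsto_ofReal (σ.tendsto_rho h0 h1)).ennrpow_const (s : ℝ)
    rwa [ENNReal.ofReal_zero, ENNReal.zero_rpow_of_pos hs0'] at this
  exact (hw0 n).not_ge (ge_of_tendsto hlim (eventually_atTop.mpr ⟨k₀ + 1, hle⟩))

/-! ### A packing winning set has large packing dimension -/

section Packing

variable {X : Type*} [PseudoMetricSpace X]

theorem packingSup_mono_set (s : ℝ≥0) (ε : ℝ) {E F : Set X} (h : E ⊆ F) :
    packingSup s ε E ≤ packingSup s ε F :=
  iSup₂_le fun P hP => le_iSup₂_of_le P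
    ⟨fun p hp => h (hP.center_mem p hp), hP.radius_pos, hP.radius_le, hP.pairwise_disjoint⟩ le_rfl

theorem packingSup_mono_radius (s : ℝ≥0) {ε ε' : ℝ} (h : ε ≤ ε') (E : Set X) :
    packingSup s ε E ≤ packingSup s ε' E :=
  iSup₂_le fun P hP => le_iSup₂_of_le P
    ⟨hP.center_mem, hP.radius_pos, fun p hp => (hP.radius_le p hp).trans h,
      hP.pairwise_disjoint⟩ le_rfl

theorem isPacking_empty (ε : ℝ) (E : Set X) : IsPacking ε E (∅ : Finset (X × ℝ)) :=
  ⟨by simp, by simp, by simp, by simp⟩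

theorem ofReal_rpow_le_packingSup (s : ℝ≥0) {ε : ℝ} (hε : 0 < ε) {E : Set X}
    (hE : E.Nonempty) : ENNReal.ofReal (2 * ε) ^ (s : ℝ) ≤ packingSup s ε E := by
  obtain ⟨x, hx⟩ := hE
  refine le_iSup₂_of_le {(x, ε)} ⟨?_, ?_, ?_, ?_⟩ (by simp)
  all_goals simp [hx, hε]

/-- `packingSup` is superadditive on sets whose distance is large compared to the radii. -/
theorem packingSup_add_le (s : ℝ≥0) {ε r : ℝ} (hr : 0 < r) (hε : 3 * ε ≤ r) {E F : Set X}
    (h : ∀ x ∈ E, ∀ y ∈ F, r ≤ dist x y) :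
    packingSup s ε E + packingSup s ε F ≤ packingSup s ε (E ∪ F) := by
  classical
  refine ENNReal.biSup_add_biSup_le' ⟨_, isPacking_empty ε E⟩ ⟨_, isPacking_empty ε F⟩ ?_
  intro P hP Q hQ
  have hdist : ∀ p ∈ P, ∀ q ∈ Q, p ≠ q := by
    rintro p hp _ hq rfl
    have := h _ (hP.center_mem p hp) _ (hQ.center_mem p hq)
    rw [dist_self] at this
    linarith
  have hdisj : ∀ p ∈ P, ∀ q ∈ Q,
      Disjoint (Metric.closedBall p.1 p.2) (Metric.closedBall q.1 q.2) := by
    intro p hp q hq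
    refine Metric.closedBall_disjoint_closedBall ?_
    have := h _ (hP.center_mem p hp) _ (hQ.center_mem q hq)
    linarith [hP.radius_le p hp, hQ.radius_le q hq]
  rw [← Finset.sum_union (Finset.disjoint_left.mpr fun p hp hq => hdist p hp p hq rfl)]
  refine le_iSup₂_of_le (P ∪ Q) ⟨?_, ?_, ?_, ?_⟩ le_rfl
  · intro p hp
    rcases Finset.mem_union.mp hp with hp | hp
    exacts [Or.inl (hP.center_mem p hp), Or.inr (hQ.center_mem p hp)]
  · intro p hp
    rcases Finset.mem_union.mp hp with hp | hp
    exacts [hP.radius_pos p hp, hQ.radius_pos p hp]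
  · intro p hp
    rcases Finset.mem_union.mp hp with hp | hp
    exacts [hP.radius_le p hp, hQ.radius_le p hp]
  · intro p hp q hq hpq
    rcases Finset.mem_union.mp hp with hp | hp <;> rcases Finset.mem_union.mp hq with hq | hq
    exacts [hP.pairwise_disjoint p hp q hq hpq, hdisj p hp q hq, (hdisj q hq p hp).symm,
      hQ.pairwise_disjoint p hp q hq hpq]

theorem sum_packingSup_le (s : ℝ≥0) {ε r : ℝ} (hr : 0 < r) (hε : 3 * ε ≤ r) {ι : Type*}
    (A : Finset ι) (F : ι → Set X)
    (h : ∀ a ∈ A, ∀ b ∈ A, a ≠ b → ∀ x ∈ F a, ∀ y ∈ F b, r ≤ dist x y) :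
    ∑ a ∈ A, packingSup s ε (F a) ≤ packingSup s ε (⋃ a ∈ A, F a) := by
  classical
  induction A using Finset.induction_on with
  | empty => simp
  | insert a A ha ih =>
    rw [Finset.sum_insert ha, Finset.set_biUnion_insert]
    refine (add_le_add le_rfl (ih fun b hb c hc => h b (Finset.mem_insert_of_mem hb) c
      (Finset.mem_insert_of_mem hc))).trans (packingSup_add_le s hr hε ?_)
    intro x hx y hy
    obtain ⟨b, hb, hy⟩ := mem_iUnion₂.mp hy
    exact h a (Finset.mem_insert_self _ _) b (Finset.mem_insert_of_mem hb)
      (by rintro rfl; exact ha hb) x hx y hy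

end Packing

open Strategy in
/-- A set that is `δ`-dimensionally packing `β`-winning for a single `β` has packing dimension at
least `δ`. By a Baire category argument a member `F` of a countable cover is dense, from some
position on, in the sets of outcomes that Bob can still reach. As `packingSup` is superadditive,
greedy moves of Bob then show that `F` has infinite packing premeasure. -/
theorem le_dimP_of_packingWinningWith {E : Type*} [MetricSpace E] [Nonempty E] {S : Set E}
    {δ : ℝ≥0} {β : ℝ} (hβ : β ∈ Ioo (0 : ℝ) 1) (h : PackingWinningWith δ β S) :
    (δ : ℝ≥0∞) ≤ dimP S := by
  obtain ⟨h0, h1⟩ := hβ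
  obtain ⟨σ, hσ, hwin⟩ := h
  refine ENNReal.le_of_forall_nnreal_lt fun s hs => ?_
  obtain ⟨s', hss', hs'⟩ := exists_between hs
  lift s' to ℝ≥0 using hs'.ne_top
  have hs'δ : (s' : ℝ) < δ := by exact_mod_cast hs'
  have hss'r : (s : ℝ) < s' := by exact_mod_cast hss'
  refine le_iSup₂_of_le s ?_ le_rfl
  rw [packingMeasure, OuterMeasure.ofFunction_apply]
  simp only [iInf_eq_top]
  intro F hF
  -- Some `F n` meets the outcomes of all the positions that can follow a certain position:
  -- otherwise Bob could avoid one of the sets after the other.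
  obtain ⟨n, k₀, x₀, hx₀, hdense⟩ : ∃ n k₀ x₀, σ.IsPosition k₀ x₀ ∧ ∀ k ≥ k₀, ∀ x,
      σ.IsPosition k x → (∀ j < k₀, x j = x₀ j) → (F n ∩ σ.outcomes k x).Nonempty := by
    by_contra! hcon
    let P : ℕ → ℕ → (ℕ → E) → Prop := fun n k x => σ.IsPosition k x ∧
      ∀ m < n, F m ∩ σ.outcomes k x = ∅
    obtain ⟨z, -, hz⟩ := exists_seq_of_extend P (k₀ := 0) (x₀ := fun _ => Classical.arbitrary E)
      ⟨fun j hj => absurd hj (Nat.not_lt_zero j), fun j hj => absurd hj (Nat.not_lt_zero j)⟩ (by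
        rintro n k x ⟨hx, hnx⟩
        obtain ⟨k', hk', x', hx', hxx', hemp⟩ := hcon n k x hx
        obtain ⟨a, ha⟩ := (hσ.2 x' k' hx').1
        have hu : ∀ j < k', Function.update x' k' a j = x' j :=
          fun j hj => Function.update_of_ne hj.ne _ _
        have hsub := σ.outcomes_update_subset k' x' a
        refine ⟨k' + 1, by omega, Function.update x' k' a, fun j hj => ?_, hx'.update ha,
          fun m hm => ?_⟩
        · rw [hu j (by omega), hxx' j hj]
        · rcases Nat.lt_succ_iff_lt_or_eq.mp hm with hm | rfl
          · exact subset_eq_empty (inter_subset_inter_right _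
              (hsub.trans (σ.outcomes_subset hk' hxx'))) (hnx m hm)
          · exact subset_eq_empty (inter_subset_inter_right _ hsub) hemp)
    have hplay : σ.IsPlay z := by
      intro k
      obtain ⟨l, hl, y, hy, hzy⟩ := hz (k + 1)
      exact hy.1.congr hzy k hl
    obtain ⟨y, hyS, hy⟩ := (hwin z hplay).1
    obtain ⟨n, hn⟩ := mem_iUnion.mp (hF hyS)
    obtain ⟨k, -, x, ⟨-, hx⟩, hzx⟩ := hz (n + 1)
    exact (hx n n.lt_succ_self).le ⟨hn, z, hplay, hzx, hy⟩
  refine ENNReal.tsum_eq_top_of_eq_top ⟨n, ?_⟩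
  simp only [packingPremeasure, iInf_eq_top]
  intro ε hε
  by_contra hfin
  obtain ⟨z₀, hz₀, hzx₀⟩ := hx₀.exists_play hσ
  obtain ⟨K, hKk, hK⟩ : ∃ K ≥ k₀, σ.rho β K / 3 ≤ ε := by
    obtain ⟨K, hK⟩ := ((eventually_ge_atTop k₀).and
      ((σ.tendsto_rho h0 h1).eventually (gt_mem_nhds (by positivity : 0 < 3 * ε)))).exists
    exact ⟨K, hK.1, by linarith [hK.2]⟩
  let f : ℕ → (ℕ → E) → ℝ≥0∞ := fun k x => packingSup s (σ.rho β k / 3) (F n ∩ σ.outcomes k x)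
  set C := f K z₀ * ENNReal.ofReal (σ.cardProd K z₀) with hC
  have hCtop : C ≠ ∞ := ENNReal.mul_ne_top (ne_top_of_le_ne_top hfin
    ((packingSup_mono_set s _ inter_subset_left).trans (packingSup_mono_radius s hK _)))
    ENNReal.ofReal_ne_top
  obtain ⟨z, hz, hzz, hzC⟩ := exists_play_mul_cardProd_le hσ f
    (fun k x z h => by simp only [f, σ.outcomes_congr h]) (hz₀.isPosition K) le_rfl (by
    intro k hk x hx hxz _
    have hρ := rho_pos hσ h0 k
    have hρ' : σ.rho β (k + 1) ≤ σ.rho β k := by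
      rw [rho_succ]; nlinarith
    refine (sum_packingSup_le s hρ (by linarith) _ _ ?_).trans
      ((packingSup_mono_set s _ ?_).trans (packingSup_mono_radius s (by linarith) _))
    · intro a ha b hb hab y hy w hw
      exact rho_le_dist_of_mem_outcomes hσ h0 hx ha hb hab hy.2 hw.2
    · exact iUnion₂_subset fun a _ =>
        inter_subset_inter_right _ (σ.outcomes_update_subset k x a))
  have hle : ∀ k ≥ K, (2 * (σ.rho β k / 3)) ^ (s : ℝ) * σ.cardProd k z ≤ C.toReal := by
    intro k hk
    have hρ := rho_pos hσ h0 k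
    have h2 := (mul_le_mul_left (ofReal_rpow_le_packingSup s (ε := σ.rho β k / 3)
      (by positivity) (hdense k (hKk.trans hk) z (hz.isPosition k) fun j hj => by
        rw [hzz j (by omega), hzx₀ j hj])) (ENNReal.ofReal (σ.cardProd k z))).trans (hzC k hk)
    rw [ENNReal.ofReal_rpow_of_pos (by positivity), ← ENNReal.ofReal_mul (by positivity)] at h2
    exact (ENNReal.ofReal_le_iff_le_toReal hCtop).mp h2
  have hscore : ((s' : ℝ) : EReal) < upperScore β (σ.response z) :=
    lt_of_lt_of_le (by exact_mod_cast hs'δ) (hwin z hz).2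
  have hfreq := frequently_lt_of_lt_limsup (by isBoundedDefault) hscore
  -- along the frequent times `k` the left side of `hle` grows like `β ^ ((s - s') k)`
  set c : ℝ := (2 * (β * σ.radius / 3)) ^ (s : ℝ) with hc
  have hc0 : 0 < c := Real.rpow_pos_of_pos (by have := hσ.1; positivity) _
  have hlim : Tendsto (fun k : ℕ => C.toReal * (β ^ ((s' : ℝ) - s)) ^ k) atTop (𝓝 0) := by
    simpa using (tendsto_pow_atTop_nhds_zero_of_lt_one (Real.rpow_nonneg h0.le _)
      (Real.rpow_lt_one h0.le h1 (sub_pos.mpr hss'r))).const_mul C.toReal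
  obtain ⟨k, hk, hkK, hk0, hkc⟩ := (hfreq.and_eventually ((eventually_ge_atTop K).and
    ((eventually_gt_atTop 0).and (hlim.eventually (gt_mem_nhds hc0))))).exists
  have hg := one_lt_of_lt_partialScore h0 h1 hz hk0 (s := s') (by exact_mod_cast hk)
  have h3 := hle (k + 1) (by omega)
  have h4 : (2 * (σ.rho β (k + 1) / 3)) ^ (s : ℝ) = c * (β ^ (s : ℝ)) ^ k := by
    rw [hc, ← Real.rpow_natCast, ← Real.rpow_mul h0.le, mul_comm (s : ℝ), Real.rpow_mul h0.le,
      Real.rpow_natCast, ← Real.mul_rpow (by have := hσ.1; positivity) (by positivity),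
      Strategy.rho]
    ring_nf
  have h5 : β ^ (s' * k : ℝ) = (β ^ (s : ℝ)) ^ k * (β ^ ((s' : ℝ) - s)) ^ k := by
    rw [← mul_pow, ← Real.rpow_add h0, Real.rpow_mul h0.le, Real.rpow_natCast]
    ring_nf
  rw [h4] at h3
  rw [h5] at hg
  have h6 : 0 < (β ^ ((s' : ℝ) - s)) ^ k := pow_pos (Real.rpow_pos_of_pos h0 _) _
  nlinarith [mul_le_mul_of_nonneg_right h3 h6.le, mul_lt_mul_of_pos_left hg hc0]

/-! ### Separated sets of heavy points -/

/-- If every nonempty subset of `G` contains a point of mass less than `t` divided by the size of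
the subset, then the total mass of `G` is less than `t` times a harmonic number. -/
theorem sum_lt_mul_harmonic {α : Type*} [DecidableEq α] (m : α → ℝ) (t : ℝ) (G : Finset α)
    (h : ∀ A ⊆ G, A.Nonempty → ∃ a ∈ A, A.card * m a < t) (hG : G.Nonempty) :
    ∑ a ∈ G, m a < t * harmonic G.card := by
  induction hn : G.card generalizing G with
  | zero => exact absurd (Finset.card_eq_zero.mp hn) hG.ne_empty
  | succ n ih =>
    obtain ⟨a, ha, hat⟩ := h G subset_rfl hG
    have hcard : (G.erase a).card = n := by rw [Finset.card_erase_of_mem ha, hn]; rfl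
    rw [hn] at hat
    have hma : m a < t * ((n + 1 : ℕ) : ℝ)⁻¹ := by
      rw [← div_eq_mul_inv, lt_div_iff₀ (by positivity), mul_comm]
      exact hat
    rw [← Finset.add_sum_erase G m ha, harmonic_succ]
    push_cast at hma ⊢
    rcases (G.erase a).eq_empty_or_nonempty with he | he
    · have : n = 0 := by rw [← hcard, he, Finset.card_empty]
      subst this
      simpa [he] using hma
    · have := ih (G.erase a) (fun A hA => h A (hA.trans (G.erase_subset a))) he hcard
      rw [mul_add]
      linarith

theorem exists_card_mul_ge {α : Type*} (m : α → ℝ) {G : Finset α} (hG : G.Nonempty) :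
    ∃ A ⊆ G, A.Nonempty ∧ ∀ a ∈ A, ∑ b ∈ G, m b ≤ harmonic G.card * (A.card * m a) := by
  classical
  have hH : (0 : ℝ) < harmonic G.card := by
    exact_mod_cast harmonic_pos (Finset.card_pos.mpr hG).ne'
  by_contra! hcon
  have := sum_lt_mul_harmonic m ((∑ b ∈ G, m b) / harmonic G.card) G (fun A hA hne => by
    obtain ⟨a, ha, hlt⟩ := hcon A hA hne
    exact ⟨a, ha, by rwa [lt_div_iff₀ hH, mul_comm]⟩) hG
  rw [div_mul_cancel₀ _ hH.ne'] at this
  exact lt_irrefl _ this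

theorem separated_insert {X : Type*} [PseudoMetricSpace X] [DecidableEq X] {r : ℝ}
    {G : Finset X} {g : X} (hsep : ∀ a ∈ G, ∀ b ∈ G, a ≠ b → r ≤ dist a b)
    (hfar : ∀ a ∈ G, r ≤ dist g a) :
    ∀ a ∈ insert g G, ∀ b ∈ insert g G, a ≠ b → r ≤ dist a b := by
  intro a ha b hb hab
  rcases Finset.mem_insert.mp ha with rfl | ha' <;> rcases Finset.mem_insert.mp hb with rfl | hb'
  · exact absurd rfl hab
  · exact hfar b hb'
  · rw [dist_comm]; exact hfar a ha'
  · exact hsep a ha' b hb' hab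

/-- Every finite set has an `r`-separated subset such that every point is close to a point of the
subset which is at least as heavy. -/
theorem exists_separated_dominating {X : Type*} [PseudoMetricSpace X] (m : X → ℝ) {r : ℝ}
    (hr : 0 < r) (F : Finset X) : ∃ G ⊆ F, (∀ a ∈ G, ∀ b ∈ G, a ≠ b → r ≤ dist a b) ∧
      ∀ a ∈ F, ∃ b ∈ G, dist a b < r ∧ m a ≤ m b := by
  classical
  induction F using Finset.strongInduction with
  | H F ih =>
    rcases F.eq_empty_or_nonempty with rfl | hF
    · exact ⟨∅, by simp⟩
    obtain ⟨g, hg, hmax⟩ := F.exists_max_image m hF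
    have hss : F.filter (fun a => r ≤ dist a g) ⊂ F :=
      Finset.filter_ssubset.mpr ⟨g, hg, by simpa using hr⟩
    obtain ⟨G, hGF, hsep, hdom⟩ := ih _ hss
    have hfar : ∀ a ∈ G, r ≤ dist g a := fun a ha => by
      rw [dist_comm]; exact (Finset.mem_filter.mp (hGF ha)).2
    refine ⟨insert g G, Finset.insert_subset hg (hGF.trans hss.subset),
      separated_insert hsep hfar, ?_⟩
    · intro a ha
      by_cases har : r ≤ dist a g
      · obtain ⟨b, hb, h⟩ := hdom a (Finset.mem_filter.mpr ⟨ha, har⟩)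
        exact ⟨b, Finset.mem_insert_of_mem hb, h⟩
      · exact ⟨g, Finset.mem_insert_self _ _, not_le.mp har, hmax a ha⟩

section Euclidean

variable {d : ℕ}

theorem card_le_of_separated {x : EuclideanSpace ℝ (Fin d)} {R r : ℝ} (hR : 0 ≤ R) (hr : 0 < r)
    (F : Finset (EuclideanSpace ℝ (Fin d))) (hF : ∀ a ∈ F, a ∈ Metric.closedBall x R)
    (hsep : ∀ a ∈ F, ∀ b ∈ F, a ≠ b → r ≤ dist a b) : (F.card : ℝ) ≤ (1 + 2 * R / r) ^ d := by
  have hdisj : (F : Set (EuclideanSpace ℝ (Fin d))).PairwiseDisjoint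
      fun a => Metric.ball a (r / 2) := fun a ha b hb hab =>
    Metric.ball_disjoint_ball (by linarith [hsep a ha b hb hab])
  have hsub : (⋃ a ∈ F, Metric.ball a (r / 2)) ⊆ Metric.ball x (R + r / 2) :=
    iUnion₂_subset fun a ha => Metric.ball_subset_ball' (by
      linarith [Metric.mem_closedBall.mp (hF a ha)])
  have hμ := measure_mono (μ := volume) hsub
  have h1 : volume (Metric.ball (0 : EuclideanSpace ℝ (Fin d)) 1) ≠ 0 :=
    (Metric.measure_ball_pos _ _ one_pos).ne'
  have h2 : volume (Metric.ball (0 : EuclideanSpace ℝ (Fin d)) 1) ≠ ∞ := measure_ball_lt_top.ne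
  rw [measure_biUnion_finset hdisj fun _ _ => measurableSet_ball,
    Measure.addHaar_ball_of_pos _ _ (by positivity : 0 < R + r / 2),
    Finset.sum_congr rfl fun a _ => Measure.addHaar_ball_of_pos volume a (half_pos hr),
    Finset.sum_const, finrank_euclideanSpace_fin, nsmul_eq_mul, ← mul_assoc,
    ENNReal.mul_le_mul_iff_left h1 h2, ← ENNReal.ofReal_natCast,
    ← ENNReal.ofReal_mul (by positivity), ENNReal.ofReal_le_ofReal_iff (by positivity)] at hμ
  have h3 : R + r / 2 = (1 + 2 * R / r) * (r / 2) := by field_simp; ring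
  rw [h3, mul_pow] at hμ
  exact le_of_mul_le_mul_right hμ (by positivity)

/-- A bounded set has a finite maximal separated subset. -/
theorem exists_maximal_separated {x : EuclideanSpace ℝ (Fin d)} {R r : ℝ} (hR : 0 ≤ R)
    (hr : 0 < r) {T : Set (EuclideanSpace ℝ (Fin d))} (hT : T ⊆ Metric.closedBall x R) :
    ∃ F : Finset (EuclideanSpace ℝ (Fin d)), ↑F ⊆ T ∧
      (∀ a ∈ F, ∀ b ∈ F, a ≠ b → r ≤ dist a b) ∧ ∀ y ∈ T, ∃ a ∈ F, dist y a < r := by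
  classical
  let P : ℕ → Prop := fun n => ∃ F : Finset (EuclideanSpace ℝ (Fin d)), ↑F ⊆ T ∧
    (∀ a ∈ F, ∀ b ∈ F, a ≠ b → r ≤ dist a b) ∧ F.card = n
  have hbound : ∀ n, P n → n ≤ ⌊(1 + 2 * R / r) ^ d⌋₊ := by
    rintro n ⟨F, hFT, hsep, rfl⟩
    exact Nat.le_floor (card_le_of_separated hR hr F (fun a ha => hT (hFT ha)) hsep)
  have h0 : P 0 := ⟨∅, by simp⟩
  obtain ⟨F, hFT, hsep, hcard⟩ := Nat.findGreatest_spec (P := P) (hbound 0 h0) h0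
  refine ⟨F, hFT, hsep, fun y hy => ?_⟩
  by_contra! hfar
  have hyF : y ∉ F := fun h => by
    have := hfar y h
    rw [dist_self] at this
    linarith
  have hP : P (F.card + 1) := by
    refine ⟨insert y F, ?_, separated_insert hsep hfar, Finset.card_insert_of_notMem hyF⟩
    rw [Finset.coe_insert]
    exact insert_subset hy hFT
  have := Nat.le_findGreatest (hbound _ hP) hP
  omega

theorem le_sum_of_subadditive {X ι : Type*} {T : Set X} {φ : Set X → ℝ} (hempty : φ ∅ = 0)
    (hmono : ∀ U V : Set X, U ⊆ V → V ⊆ T → φ U ≤ φ V)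
    (hsub : ∀ U V : Set X, U ⊆ T → V ⊆ T → φ (U ∪ V) ≤ φ U + φ V)
    (F : Finset ι) (B : ι → Set X) (hcov : T ⊆ ⋃ a ∈ F, B a) :
    φ T ≤ ∑ a ∈ F, φ (T ∩ B a) := by
  classical
  have key : ∀ F : Finset ι, φ (⋃ a ∈ F, T ∩ B a) ≤ ∑ a ∈ F, φ (T ∩ B a) := by
    intro F
    induction F using Finset.induction_on with
    | empty => simp [hempty]
    | insert a F ha ih =>
      rw [Finset.sum_insert ha, Finset.set_biUnion_insert]
      exact (hsub _ _ inter_subset_left (iUnion₂_subset fun _ _ => inter_subset_left)).trans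
        (add_le_add le_rfl ih)
  refine le_trans (hmono _ _ (fun y hy => ?_) (iUnion₂_subset fun _ _ => inter_subset_left)) (key F)
  obtain ⟨a, ha, hya⟩ := mem_iUnion₂.mp (hcov hy)
  exact mem_iUnion₂.mpr ⟨a, ha, hy, hya⟩

/-- The factor that Alice loses in every turn. It grows only like `log (1 / β)`. -/
noncomputable def lossFactor (d : ℕ) (β : ℝ) : ℝ := 13 ^ d * (1 + d * -Real.log β)

theorem one_le_lossFactor (d : ℕ) {β : ℝ} (h0 : 0 < β) (h1 : β < 1) : 1 ≤ lossFactor d β := by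
  have hlog : 0 ≤ -Real.log β := by linarith [Real.log_neg h0 h1]
  exact one_le_mul_of_one_le_of_one_le (one_le_pow₀ (by norm_num))
    (le_add_of_nonneg_right (by positivity))

/-- Alice's basic move. For a monotone and subadditive set function `φ` she can choose a
`3βρ`-separated set `A` of points `a` around which, on the scale `βρ`, the set `T` has at least
the share `φ T / #A` of the total mass, up to a factor that is logarithmic in `β`: she orders the
points of a separated set by mass and takes those up to the right rank. -/
theorem exists_heavy_separated {x : EuclideanSpace ℝ (Fin d)} {β ρ : ℝ} (hβ : 0 < β)
    (hβ1 : β ≤ 1 / 4) (hρ : 0 < ρ) {T : Set (EuclideanSpace ℝ (Fin d))} (hne : T.Nonempty)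
    (hT : T ⊆ Metric.closedBall x ρ) {φ : Set (EuclideanSpace ℝ (Fin d)) → ℝ} (hempty : φ ∅ = 0)
    (hmono : ∀ U V, U ⊆ V → V ⊆ T → φ U ≤ φ V)
    (hsub : ∀ U V, U ⊆ T → V ⊆ T → φ (U ∪ V) ≤ φ U + φ V) :
    ∃ A : Finset (EuclideanSpace ℝ (Fin d)), A.Nonempty ∧ ↑A ⊆ T ∧
      (∀ a ∈ A, ∀ b ∈ A, a ≠ b → 3 * (β * ρ) ≤ dist a b) ∧
      ∀ a ∈ A, φ T ≤ lossFactor d β * (A.card * φ (T ∩ Metric.closedBall a (β * ρ / 2))) := by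
  classical
  set r := β * ρ with hr
  have hr0 : 0 < r := mul_pos hβ hρ
  have hφ : ∀ U, U ⊆ T → 0 ≤ φ U := fun U hU => by
    simpa [hempty] using hmono ∅ U (empty_subset U) hU
  let m : EuclideanSpace ℝ (Fin d) → ℝ := fun a => φ (T ∩ Metric.closedBall a (r / 2))
  have hm : ∀ a, 0 ≤ m a := fun a => hφ _ inter_subset_left
  obtain ⟨F, hFT, hFsep, hFcov⟩ := exists_maximal_separated hρ.le (half_pos hr0) hT
  obtain ⟨G, hGF, hGsep, hGdom⟩ := exists_separated_dominating m (by positivity : 0 < 3 * r) F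
  have hGne : G.Nonempty := by
    obtain ⟨y, hy⟩ := hne
    obtain ⟨a, ha, -⟩ := hFcov y hy
    obtain ⟨b, hb, -⟩ := hGdom a ha
    exact ⟨b, hb⟩
  obtain ⟨A, hAG, hAne, hA⟩ := exists_card_mul_ge m hGne
  have hAT : (A : Set (EuclideanSpace ℝ (Fin d))) ⊆ T := fun a ha => hFT (hGF (hAG ha))
  refine ⟨A, hAne, hAT, fun a ha b hb => hGsep a (hAG ha) b (hAG hb), fun a ha => ?_⟩
  have h1 : φ T ≤ ∑ a ∈ F, m a := by
    refine le_sum_of_subadditive hempty hmono hsub F _ fun y hy => ?_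
    obtain ⟨a, ha, hya⟩ := hFcov y hy
    exact mem_iUnion₂.mpr ⟨a, ha, hya.le⟩
  -- every point of `G` dominates at most `13 ^ d` points of `F`
  have h2 : ∑ a ∈ F, m a ≤ 13 ^ d * ∑ b ∈ G, m b := by
    choose! g hg hdist hle using hGdom
    rw [← Finset.sum_fiberwise_of_maps_to hg, Finset.mul_sum]
    refine Finset.sum_le_sum fun b hb => ?_
    have hcard : ((F.filter fun a => g a = b).card : ℝ) ≤ 13 ^ d := by
      have := card_le_of_separated (x := b) (R := 3 * r) (by positivity) (half_pos hr0)
        (F.filter fun a => g a = b) (fun a ha => by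
          obtain ⟨haF, rfl⟩ := Finset.mem_filter.mp ha
          exact (hdist a haF).le)
        (fun a ha b hb => hFsep a (Finset.mem_filter.mp ha).1 b (Finset.mem_filter.mp hb).1)
      have h13 : 1 + 2 * (3 * r) / (r / 2) = 13 := by field_simp; norm_num
      rwa [h13] at this
    calc ∑ a ∈ F with g a = b, m a ≤ ∑ a ∈ F with g a = b, m b :=
          Finset.sum_le_sum fun a ha => by
            obtain ⟨haF, rfl⟩ := Finset.mem_filter.mp ha
            exact hle a haF
      _ = (F.filter fun a => g a = b).card * m b := by rw [Finset.sum_const, nsmul_eq_mul]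
      _ ≤ 13 ^ d * m b := mul_le_mul_of_nonneg_right hcard (hm b)
  have h3 : (harmonic G.card : ℝ) ≤ 1 + d * -Real.log β := by
    have hcard := card_le_of_separated hρ.le (by positivity : 0 < 3 * r) G
      (fun a ha => hT (hFT (hGF ha))) hGsep
    have hbase : 1 + 2 * ρ / (3 * r) ≤ β⁻¹ := by
      have : 1 + 2 * ρ / (3 * r) = (β + 2 / 3) * β⁻¹ := by rw [hr]; field_simp
      rw [this]
      exact mul_le_of_le_one_left (by positivity) (by linarith)
    have hcard' : (G.card : ℝ) ≤ β⁻¹ ^ d :=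
      hcard.trans (pow_le_pow_left₀ (by positivity) hbase d)
    have := Real.log_le_log (by exact_mod_cast Finset.card_pos.mpr hGne) hcard'
    rw [Real.log_pow, Real.log_inv] at this
    linarith [harmonic_le_one_add_log G.card]
  have h4 : 0 ≤ A.card * m a := mul_nonneg (Nat.cast_nonneg _) (hm a)
  calc φ T ≤ 13 ^ d * ∑ b ∈ G, m b := h1.trans h2
    _ ≤ 13 ^ d * (harmonic G.card * (A.card * m a)) := by gcongr; exact hA a ha
    _ ≤ 13 ^ d * ((1 + d * -Real.log β) * (A.card * m a)) := by gcongr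
    _ = lossFactor d β * (A.card * m a) := by rw [lossFactor]; ring

/-- The loss per turn becomes negligible as `β → 0`. -/
theorem exists_forall_lossFactor_lt (d : ℕ) {η : ℝ} (hη : 0 < η) :
    ∃ β₀ ∈ Ioo (0 : ℝ) 1, ∀ β ∈ Ioo (0 : ℝ) β₀,
      Real.log (2 * lossFactor d β) < η * -Real.log β := by
  have h1 : Tendsto (fun t : ℝ => 2 * 13 ^ d * (1 + d * t) / Real.exp (η * t)) atTop (𝓝 0) := by
    have h0 := (isLittleO_pow_exp_pos_mul_atTop 0 hη).tendsto_div_nhds_zero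
    have h1' := (isLittleO_pow_exp_pos_mul_atTop 1 hη).tendsto_div_nhds_zero
    have := (h0.const_mul ((2 : ℝ) * 13 ^ d)).add (h1'.const_mul ((2 : ℝ) * 13 ^ d * d))
    simp only [mul_zero, add_zero] at this
    refine this.congr fun t => ?_
    simp only [pow_zero, pow_one]
    ring
  obtain ⟨t₀, ht₀⟩ := eventually_atTop.mp (h1.eventually (gt_mem_nhds one_pos))
  refine ⟨Real.exp (-(max t₀ 1)), ⟨Real.exp_pos _, ?_⟩, fun β ⟨hβ, hβt⟩ => ?_⟩
  · rw [Real.exp_lt_one_iff]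
    linarith [le_max_right t₀ 1]
  · have hlog : Real.log β < -(max t₀ 1) := (Real.log_lt_iff_lt_exp hβ).mpr hβt
    have ht : max t₀ 1 ≤ -Real.log β := by linarith
    have h2 := ht₀ _ ((le_max_left _ _).trans ht)
    rw [div_lt_one (Real.exp_pos _)] at h2
    have hpos : 0 ≤ -Real.log β := by linarith [le_max_right t₀ 1]
    rw [Real.log_lt_iff_lt_exp (by unfold lossFactor; positivity), lossFactor, ← mul_assoc]
    exact h2

end Euclidean

/-! ### Net contents and the increasing sets lemma -/

/-- A net: a family of cells with levels such that a cell contains every cell of at least the same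
level that it meets, and distinct cells of the same level are disjoint. -/
structure IsNet {X ι : Type*} (cell : ι → Set X) (level : ι → ℕ) : Prop where
  subset_of_level_le : ∀ i j, level i ≤ level j → (cell i ∩ cell j).Nonempty → cell j ⊆ cell i
  eq_of_level_eq : ∀ i j, level i = level j → (cell i ∩ cell j).Nonempty → i = j

/-- The content of `E` with respect to weighted cells: the infimum of the total weights of the
families of cells that cover `E`. -/
noncomputable def netContent {X ι : Type*} (cell : ι → Set X) (w : ι → ℝ≥0∞) (E : Set X) :
    ℝ≥0∞ :=
  ⨅ (D : Set ι) (_ : E ⊆ ⋃ i ∈ D, cell i), ∑' i : D, w i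

section Net

variable {X ι : Type*} {cell : ι → Set X} {w : ι → ℝ≥0∞}

theorem netContent_le {E : Set X} {D : Set ι} (h : E ⊆ ⋃ i ∈ D, cell i) :
    netContent cell w E ≤ ∑' i : D, w i := iInf₂_le D h

theorem netContent_mono {E F : Set X} (h : E ⊆ F) : netContent cell w E ≤ netContent cell w F :=
  le_iInf₂ fun _ hD => netContent_le (h.trans hD)

theorem netContent_empty : netContent cell w ∅ = 0 :=
  le_antisymm ((netContent_le (D := ∅) (by simp)).trans (by simp)) zero_le

theorem exists_cover_lt_of_netContent_lt {E : Set X} {c : ℝ≥0∞} (h : netContent cell w E < c) :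
    ∃ D : Set ι, E ⊆ ⋃ i ∈ D, cell i ∧ ∑' i : D, w i < c := by
  simp only [netContent, iInf_lt_iff] at h
  obtain ⟨D, hD, h⟩ := h
  exact ⟨D, hD, h⟩

theorem netContent_union_le (E F : Set X) :
    netContent cell w (E ∪ F) ≤ netContent cell w E + netContent cell w F := by
  refine ENNReal.le_of_forall_pos_le_add fun ε hε hlt => ?_
  have hE : netContent cell w E ≠ ∞ := (lt_of_le_of_lt le_self_add hlt).ne
  have hF : netContent cell w F ≠ ∞ := (lt_of_le_of_lt le_add_self hlt).ne
  have hε' : (ε : ℝ≥0∞) / 2 ≠ 0 := by simpa using hε.ne'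
  obtain ⟨D, hD, hDs⟩ := exists_cover_lt_of_netContent_lt (ENNReal.lt_add_right hE hε')
  obtain ⟨D', hD', hDs'⟩ := exists_cover_lt_of_netContent_lt (ENNReal.lt_add_right hF hε')
  calc netContent cell w (E ∪ F) ≤ ∑' i : (D ∪ D' : Set ι), w i := netContent_le (by
        rw [biUnion_union]
        exact union_subset_union hD hD')
    _ ≤ ∑' i : D, w i + ∑' i : D', w i := ENNReal.tsum_union_le _ _ _
    _ ≤ _ := add_le_add hDs.le hDs'.le
    _ = netContent cell w E + netContent cell w F + (ε / 2 + ε / 2) := by ring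
    _ = _ := by rw [ENNReal.add_halves]

/-- One step of the exchange argument behind the increasing sets lemma. If `D` is a nearly optimal
cover of `E`, with defect `η`, and `C` is a cover of the larger set `F`, then the maximal cells of
`C ∪ D` cover `F` and every cell of `D`, and weigh at most `η` more than `C`. -/
theorem exists_exchange {level : ι → ℕ} (hnet : IsNet cell level) {E F : Set X} (hEF : E ⊆ F)
    {C D : Set ι} {η : ℝ≥0∞} (hD : E ⊆ ⋃ i ∈ D, cell i) (hC : F ⊆ ⋃ i ∈ C, cell i)
    (hDw : ∑' i : D, w i ≤ netContent cell w E + η) (hfin : ∑' i : D, w i ≠ ∞) :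
    ∃ D' : Set ι, F ⊆ ⋃ i ∈ D', cell i ∧
      (∀ i ∈ D, ∃ j ∈ D', level j ≤ level i ∧ cell i ⊆ cell j) ∧
      ∑' i : D', w i ≤ ∑' i : C, w i + η := by
  let below : ι → ι → Prop := fun i j => level j ≤ level i ∧ (cell j ∩ cell i).Nonempty
  have hbelow : ∀ {i j}, below i j → cell i ⊆ cell j := fun h =>
    hnet.subset_of_level_le _ _ h.1 h.2
  let U : Set ι := {i ∈ D | ∃ j ∈ C, below i j}
  let V : Set ι := D \ U
  let Z : Set ι := {j ∈ C | ∃ i ∈ V, below j i}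
  have hCmem : ∀ j ∈ C, ∃ k ∈ V ∪ C \ Z, level k ≤ level j ∧ cell j ⊆ cell k := by
    intro j hj
    by_cases hjZ : j ∈ Z
    · obtain ⟨-, i, hi, hji⟩ := hjZ
      exact ⟨i, Or.inl hi, hji.1, hbelow hji⟩
    · exact ⟨j, Or.inr ⟨hj, hjZ⟩, le_rfl, subset_rfl⟩
  refine ⟨V ∪ C \ Z, ?_, ?_, ?_⟩
  · intro x hx
    obtain ⟨j, hj, hxj⟩ := mem_iUnion₂.mp (hC hx)
    obtain ⟨k, hk, -, hjk⟩ := hCmem j hj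
    exact mem_iUnion₂.mpr ⟨k, hk, hjk hxj⟩
  · intro i hi
    by_cases hiU : i ∈ U
    · obtain ⟨-, j, hj, hij⟩ := hiU
      obtain ⟨k, hk, hl, hjk⟩ := hCmem j hj
      exact ⟨k, hk, hl.trans hij.1, (hbelow hij).trans hjk⟩
    · exact ⟨i, Or.inl ⟨hi, hiU⟩, le_rfl, subset_rfl⟩
  · -- `U ∪ Z` still covers `E`, so that the cells in `V` weigh at most `η` more than those in `Z`
    have hcov : E ⊆ ⋃ i ∈ U ∪ Z, cell i := by
      intro x hx
      obtain ⟨i, hi, hxi⟩ := mem_iUnion₂.mp (hD hx)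
      obtain ⟨j, hj, hxj⟩ := mem_iUnion₂.mp (hC (hEF hx))
      by_cases hiU : i ∈ U
      · exact mem_iUnion₂.mpr ⟨i, Or.inl hiU, hxi⟩
      · have hji : level i ≤ level j := by
          by_contra! h
          exact hiU ⟨hi, j, hj, h.le, x, hxj, hxi⟩
        exact mem_iUnion₂.mpr ⟨j, Or.inr ⟨hj, i, ⟨hi, hiU⟩, hji, x, hxi, hxj⟩, hxj⟩
    have hUD : U ⊆ D := fun i hi => hi.1
    have hZC : Z ⊆ C := fun i hi => hi.1
    have hsplitD : ∑' i : D, w i = ∑' i : U, w i + ∑' i : V, w i := by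
      rw [← ENNReal.summable.tsum_union_disjoint disjoint_sdiff_right ENNReal.summable,
        union_sdiff_cancel hUD]
    have hsplitC : ∑' i : C, w i = ∑' i : Z, w i + ∑' i : (C \ Z : Set ι), w i := by
      rw [← ENNReal.summable.tsum_union_disjoint disjoint_sdiff_right ENNReal.summable,
        union_sdiff_cancel hZC]
    have hUfin : ∑' i : U, w i ≠ ∞ := by
      rw [hsplitD] at hfin
      exact (ENNReal.add_ne_top.mp hfin).1
    have hV : ∑' i : V, w i ≤ ∑' i : Z, w i + η := by
      refine (ENNReal.add_le_add_iff_left hUfin).mp ?_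
      calc ∑' i : U, w i + ∑' i : V, w i = ∑' i : D, w i := hsplitD.symm
        _ ≤ netContent cell w E + η := hDw
        _ ≤ (∑' i : U, w i + ∑' i : Z, w i) + η :=
          add_le_add ((netContent_le hcov).trans (ENNReal.tsum_union_le _ _ _)) le_rfl
        _ = _ := add_assoc _ _ _
    calc ∑' i : (V ∪ C \ Z : Set ι), w i
        ≤ ∑' i : V, w i + ∑' i : (C \ Z : Set ι), w i := ENNReal.tsum_union_le _ _ _
      _ ≤ (∑' i : Z, w i + η) + ∑' i : (C \ Z : Set ι), w i := add_le_add hV le_rfl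
      _ = ∑' i : C, w i + η := by rw [hsplitC]; ring

/-- **Increasing sets lemma.** Net contents are continuous along increasing sequences of arbitrary
sets. -/
theorem netContent_iUnion_le {level : ι → ℕ} (hnet : IsNet cell level) {E : ℕ → Set X}
    (hE : Monotone E) {c : ℝ≥0∞} (hc : ∀ n, netContent cell w (E n) ≤ c) :
    netContent cell w (⋃ n, E n) ≤ c := by
  refine ENNReal.le_of_forall_pos_le_add fun ε hε hctop => ?_
  obtain ⟨e, he, hesum⟩ := ENNReal.exists_pos_sum_of_countable'
    (by simpa using hε.ne' : (ε : ℝ≥0∞) ≠ 0) ℕ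
  have hefin : ∀ n, ∑ m ∈ Finset.range n, e m ≤ ε := fun n =>
    (ENNReal.sum_le_tsum _).trans hesum.le
  have hEfin : ∀ n, netContent cell w (E n) ≠ ∞ := fun n => ((hc n).trans_lt hctop).ne
  choose C hC hCw using fun n =>
    exists_cover_lt_of_netContent_lt (ENNReal.lt_add_right (hEfin n) (he n).ne')
  let IsGood : ℕ → Set ι → Prop := fun n D => E n ⊆ ⋃ i ∈ D, cell i ∧
    ∑' i : D, w i ≤ netContent cell w (E n) + ∑ m ∈ Finset.range (n + 1), e m
  have hstep : ∀ n (D : {D // IsGood n D}), ∃ D' : {D' // IsGood (n + 1) D'},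
      ∀ i ∈ D.1, ∃ j ∈ D'.1, level j ≤ level i ∧ cell i ⊆ cell j := by
    rintro n ⟨D, hD, hDw⟩
    obtain ⟨D', hcov, hdom, hw⟩ := exists_exchange hnet (hE n.le_succ) hD (hC (n + 1)) hDw
      (ne_top_of_le_ne_top (ENNReal.add_ne_top.mpr
        ⟨hEfin n, ne_top_of_le_ne_top ENNReal.coe_ne_top (hefin _)⟩) hDw)
    refine ⟨⟨D', hcov, hw.trans ?_⟩, hdom⟩
    rw [Finset.sum_range_succ _ (n + 1)]
    calc _ ≤ (netContent cell w (E (n + 1)) + e (n + 1)) + ∑ m ∈ Finset.range (n + 1), e m :=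
          add_le_add (hCw (n + 1)).le le_rfl
      _ = _ := by ring
  choose next hnext using hstep
  let D : ∀ n, {D // IsGood n D} := fun n =>
    Nat.rec ⟨C 0, hC 0, by simpa using (hCw 0).le⟩ (fun n D => next n D) n
  have hDnext : ∀ n, ∀ i ∈ (D n).1, ∃ j ∈ (D (n + 1)).1, level j ≤ level i ∧ cell i ⊆ cell j :=
    fun n => hnext n (D n)
  -- the cells that belong to all but finitely many of the covers
  let L : Set ι := {i | ∃ n, ∀ m ≥ n, i ∈ (D m).1}
  have hL : ⋃ n, E n ⊆ ⋃ i ∈ L, cell i := by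
    intro x hx
    obtain ⟨n₀, hx⟩ := mem_iUnion.mp hx
    obtain ⟨i₀, hi₀, hxi₀⟩ := mem_iUnion₂.mp ((D n₀).2.1 hx)
    classical
    -- a cell of minimal level among those that contain `x` and occur in one of the covers
    have hex : ∃ l, ∃ i, level i = l ∧ x ∈ cell i ∧ ∃ n, i ∈ (D n).1 :=
      ⟨_, i₀, rfl, hxi₀, n₀, hi₀⟩
    obtain ⟨i, hil, hxi, n, hin⟩ := Nat.find_spec hex
    refine mem_iUnion₂.mpr ⟨i, ⟨n, fun m hm => ?_⟩, hxi⟩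
    induction m, hm using Nat.le_induction with
    | base => exact hin
    | succ m _ ih =>
      obtain ⟨j, hj, hji, hsub⟩ := hDnext m i ih
      have hij : level i ≤ level j := by
        rw [hil]
        exact Nat.find_min' hex ⟨j, rfl, hsub hxi, m + 1, hj⟩
      rwa [hnet.eq_of_level_eq i j (le_antisymm hij hji) ⟨x, hxi, hsub hxi⟩]
  refine (netContent_le hL).trans ?_
  rw [ENNReal.tsum_eq_iSup_sum]
  refine iSup_le fun s => ?_
  choose N hN using fun i : L => i.2
  set n := s.sup N
  calc ∑ i ∈ s, w i = ∑ i ∈ s.map (Function.Embedding.subtype _), w i := by simp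
    _ ≤ ∑' i : (D n).1, w i := by
      rw [tsum_subtype (D n).1 w]
      refine le_trans (le_of_eq (Finset.sum_congr rfl fun i hi => ?_))
        (ENNReal.sum_le_tsum (s.map (Function.Embedding.subtype _)))
      obtain ⟨j, hj, rfl⟩ := Finset.mem_map.mp hi
      exact (indicator_of_mem (hN j n (Finset.le_sup hj)) w).symm
    _ ≤ netContent cell w (E n) + ∑ m ∈ Finset.range (n + 1), e m := (D n).2.2
    _ ≤ c + ε := add_le_add (hc n) (hefin _)

theorem netContent_iUnion_eq_zero {level : ι → ℕ} (hnet : IsNet cell level) {E : ℕ → Set X}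
    (hE : ∀ n, netContent cell w (E n) = 0) : netContent cell w (⋃ n, E n) = 0 := by
  rw [← iUnion_accumulate]
  refine le_antisymm (netContent_iUnion_le hnet monotone_accumulate fun n => ?_) zero_le
  induction n with
  | zero => simp [accumulate_zero_nat, hE]
  | succ n ih =>
    rw [accumulate_succ]
    exact (netContent_union_le _ _).trans (by rw [hE, add_zero]; exact ih)

end Net

/-! ### The dyadic net content -/

/-- The half-open dyadic cube of side length `2 ^ (-n)` with index `z`, where `q = (n, z)`. -/
def dyadicCube (d : ℕ) (q : ℕ × (Fin d → ℤ)) : Set (EuclideanSpace ℝ (Fin d)) :=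
  {x | ∀ i, ⌊(2 : ℝ) ^ q.1 * x i⌋ = q.2 i}

theorem isNet_dyadicCube (d : ℕ) : IsNet (dyadicCube d) Prod.fst where
  subset_of_level_le := by
    rintro ⟨n, z⟩ ⟨m, z'⟩ hnm ⟨y, hy, hy'⟩ x hx i
    obtain ⟨k, rfl⟩ : ∃ k, m = n + k := ⟨m - n, (Nat.add_sub_cancel' hnm).symm⟩
    have key : ∀ t : ℝ, ⌊(2 : ℝ) ^ n * t⌋ = ⌊(2 : ℝ) ^ (n + k) * t⌋ / ((2 ^ k : ℕ) : ℤ) := by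
      intro t
      rw [← Int.floor_div_natCast]
      congr 1
      push_cast
      field_simp
      ring
    have hxy : ⌊(2 : ℝ) ^ (n + k) * x i⌋ = ⌊(2 : ℝ) ^ (n + k) * y i⌋ := (hx i).trans (hy' i).symm
    exact (key (x i)).trans ((congrArg (· / _) hxy).trans ((key (y i)).symm.trans (hy i)))
  eq_of_level_eq := by
    rintro ⟨n, z⟩ ⟨m, z'⟩ hnm ⟨y, hy, hy'⟩
    obtain rfl : n = m := hnm
    exact congrArg (Prod.mk n) (funext fun i => (hy i).symm.trans (hy' i))

theorem mem_dyadicCube_floor {d : ℕ} (n : ℕ) (x : EuclideanSpace ℝ (Fin d)) :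
    x ∈ dyadicCube d (n, fun i => ⌊(2 : ℝ) ^ n * x i⌋) := fun _ => rfl

theorem ediam_dyadicCube_le (d : ℕ) (q : ℕ × (Fin d → ℤ)) :
    Metric.ediam (dyadicCube d q) ≤ ENNReal.ofReal √d * ENNReal.ofReal ((1 / 2) ^ q.1) := by
  refine Metric.ediam_le fun x hx y hy => ?_
  rw [edist_dist, ← ENNReal.ofReal_mul (Real.sqrt_nonneg _)]
  refine ENNReal.ofReal_le_ofReal ?_
  have hi : ∀ i, dist (x i) (y i) ≤ (1 / 2) ^ q.1 := by
    intro i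
    have h := Int.abs_sub_lt_one_of_floor_eq_floor ((hx i).trans (hy i).symm)
    rw [← mul_sub, abs_mul, abs_of_pos (by positivity)] at h
    rw [Real.dist_eq, one_div, inv_pow, ← one_div, le_div_iff₀ (by positivity), mul_comm]
    exact h.le
  rw [EuclideanSpace.dist_eq]
  calc √(∑ i, dist (x i) (y i) ^ 2) ≤ √(∑ _i : Fin d, ((1 / 2 : ℝ) ^ q.1) ^ 2) :=
        Real.sqrt_le_sqrt (Finset.sum_le_sum fun i _ => pow_le_pow_left₀ dist_nonneg (hi i) 2)
    _ = √d * (1 / 2) ^ q.1 := by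
        rw [Finset.sum_const, Finset.card_univ, Fintype.card_fin, nsmul_eq_mul,
          Real.sqrt_mul (Nat.cast_nonneg _), Real.sqrt_sq (by positivity)]

/-- The `s`-dimensional dyadic content, where only cubes of side length at most `1` are used. -/
noncomputable def dyadicContent (d : ℕ) (s : ℝ) (E : Set (EuclideanSpace ℝ (Fin d))) : ℝ≥0∞ :=
  netContent (dyadicCube d) (fun q => ENNReal.ofReal ((1 / 2) ^ q.1) ^ s) E

theorem dyadicContent_closedBall_le (d : ℕ) {s : ℝ} (hs : 0 ≤ s) (x : EuclideanSpace ℝ (Fin d))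
    {r : ℝ} (hr0 : 0 < r) (hr1 : r ≤ 1) :
    dyadicContent d s (Metric.closedBall x r) ≤ 3 ^ d * ENNReal.ofReal (2 * r) ^ s := by
  classical
  obtain ⟨n, hn, hn'⟩ := exists_nat_pow_near_of_lt_one hr0 hr1
    (by norm_num : (0 : ℝ) < 1 / 2) (by norm_num)
  let J : Finset (Fin d → ℤ) := Fintype.piFinset fun i =>
    Finset.Icc (⌊(2 : ℝ) ^ n * x i⌋ - 1) (⌊(2 : ℝ) ^ n * x i⌋ + 1)
  let D : Finset (ℕ × (Fin d → ℤ)) := J.map ⟨Prod.mk n, Prod.mk_right_injective n⟩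
  have hcov : Metric.closedBall x r ⊆ ⋃ q ∈ (D : Set (ℕ × (Fin d → ℤ))), dyadicCube d q := by
    intro y hy
    refine mem_iUnion₂.mpr ⟨_, ?_, mem_dyadicCube_floor n y⟩
    refine Finset.mem_coe.mpr (Finset.mem_map.mpr ⟨_, Fintype.mem_piFinset.mpr fun i => ?_, rfl⟩)
    have h1 : |y i - x i| ≤ (1 / 2) ^ n :=
      ((EuclideanSpace.norm_eq (y - x) ▸ PiLp.norm_apply_le (y - x) i :
        ‖(y - x) i‖ ≤ _).trans (by
          rw [← EuclideanSpace.norm_eq, ← dist_eq_norm]; exact hy)).trans hn'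
    have h2 : |(2 : ℝ) ^ n * y i - 2 ^ n * x i| ≤ 1 := by
      rw [← mul_sub, abs_mul, abs_of_pos (by positivity)]
      calc (2 : ℝ) ^ n * |y i - x i| ≤ 2 ^ n * (1 / 2) ^ n := by gcongr
        _ = 1 := by rw [← mul_pow]; norm_num
    obtain ⟨h3, h4⟩ := abs_le.mp h2
    rw [Finset.mem_Icc, ← Int.floor_sub_one, ← Int.floor_add_one]
    exact ⟨Int.floor_le_floor (by linarith), Int.floor_le_floor (by linarith)⟩
  have hcard : D.card = 3 ^ d := by
    rw [Finset.card_map, Fintype.card_piFinset]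
    simp only [Int.card_Icc]
    rw [Finset.prod_congr rfl (g := fun _ => 3) fun i _ => by omega]
    simp
  refine (netContent_le hcov).trans ?_
  rw [Finset.tsum_subtype' D (fun q => ENNReal.ofReal ((1 / 2) ^ q.1) ^ s)]
  have : ∀ q ∈ D, ENNReal.ofReal ((1 / 2) ^ q.1) ^ s ≤ ENNReal.ofReal (2 * r) ^ s := by
    intro q hq
    obtain ⟨z, -, rfl⟩ := Finset.mem_map.mp hq
    refine ENNReal.rpow_le_rpow (ENNReal.ofReal_le_ofReal ?_) hs
    have : (1 / 2 : ℝ) ^ n = 2 * (1 / 2) ^ (n + 1) := by rw [pow_succ]; ring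
    change (1 / 2 : ℝ) ^ n ≤ 2 * r
    linarith
  refine (Finset.sum_le_card_nsmul _ _ _ this).trans (le_of_eq ?_)
  rw [hcard, nsmul_eq_mul]
  push_cast
  rfl

theorem hausdorffMeasure_eq_zero_of_dyadicContent_eq_zero {d : ℕ} {s : ℝ} (hs : 0 < s)
    {E : Set (EuclideanSpace ℝ (Fin d))} (h : dyadicContent d s E = 0) : μH[s] E = 0 := by
  have hpos : ∀ n : ℕ, dyadicContent d s E < ((n : ℝ≥0∞))⁻¹ := fun n => by
    rw [h]; simp
  choose D hD hDw using fun n => exists_cover_lt_of_netContent_lt (hpos n)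
  have hinv : Tendsto (fun n : ℕ => ((n : ℝ≥0∞))⁻¹) atTop (𝓝 0) :=
    ENNReal.tendsto_inv_nat_nhds_zero
  have hr : Tendsto (fun n : ℕ => ENNReal.ofReal √d * ((n : ℝ≥0∞))⁻¹ ^ s⁻¹) atTop (𝓝 0) := by
    have := ENNReal.Tendsto.const_mul (a := ENNReal.ofReal √d) (hinv.ennrpow_const s⁻¹)
      (Or.inr ENNReal.ofReal_ne_top)
    rwa [ENNReal.zero_rpow_of_pos (inv_pos.mpr hs), mul_zero] at this
  have hle := Measure.hausdorffMeasure_le_liminf_tsum s E _ hr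
    (fun n (q : D n) => dyadicCube d q.1) (Eventually.of_forall fun n q => by
      refine (ediam_dyadicCube_le d q.1).trans ?_
      gcongr
      rw [← ENNReal.rpow_le_rpow_iff hs, ENNReal.rpow_inv_rpow hs.ne']
      exact (ENNReal.le_tsum q).trans (hDw n).le)
    (Eventually.of_forall fun n => (hD n).trans
      (iUnion₂_subset fun q hq => subset_iUnion_of_subset ⟨q, hq⟩ subset_rfl))
  have hlim : Tendsto (fun n : ℕ => ENNReal.ofReal √d ^ s * (n : ℝ≥0∞)⁻¹) atTop (𝓝 0) := by
    have := ENNReal.Tendsto.const_mul (a := ENNReal.ofReal √d ^ s) hinv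
      (Or.inr (ENNReal.rpow_ne_top_of_nonneg hs.le ENNReal.ofReal_ne_top))
    rwa [mul_zero] at this
  have hsum : ∀ n : ℕ, ∑' q : D n, Metric.ediam (dyadicCube d q.1) ^ s ≤
      ENNReal.ofReal √d ^ s * (n : ℝ≥0∞)⁻¹ := by
    intro n
    calc ∑' q : D n, Metric.ediam (dyadicCube d q.1) ^ s
        ≤ ∑' q : D n, ENNReal.ofReal √d ^ s * ENNReal.ofReal ((1 / 2) ^ q.1.1) ^ s :=
          ENNReal.tsum_le_tsum fun q => by
            rw [← ENNReal.mul_rpow_of_nonneg _ _ hs.le]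
            exact ENNReal.rpow_le_rpow (ediam_dyadicCube_le d q.1) hs.le
      _ = ENNReal.ofReal √d ^ s * ∑' q : D n, ENNReal.ofReal ((1 / 2) ^ q.1.1) ^ s :=
          ENNReal.tsum_mul_left
      _ ≤ _ := by gcongr; exact (hDw n).le
  exact le_antisymm ((hle.trans (liminf_le_liminf (Eventually.of_forall hsum))).trans_eq
    hlim.liminf_eq) zero_le

/-! ### Building strategies for Alice -/

/-- Alice can play by keeping track of an auxiliary state: if every legal pair of a center and a
state allows a legal move, all of whose points can be assigned a legal new state, then she has a
strategy along every play of which there are such states. -/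
theorem exists_strategy_of_states {E St : Type*} [PseudoMetricSpace E] {β ρ₀ : ℝ} (hρ₀ : 0 < ρ₀)
    (Inv : ℕ → E → St → Prop) (Step : ℕ → St → Finset E → St → Prop) {x₀ : E} {st₀ : St}
    (h₀ : Inv 0 x₀ st₀)
    (hstep : ∀ k x st, Inv k x st → ∃ A : Finset E, A.Nonempty ∧
      (∀ a ∈ A, ∀ b ∈ A, a ≠ b → 3 * (β ^ (k + 1) * ρ₀) ≤ dist a b) ∧
      (∀ a ∈ A, a ∈ Metric.closedBall x ((1 - β) * (β ^ k * ρ₀))) ∧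
      ∀ a ∈ A, ∃ st', Inv (k + 1) a st' ∧ Step k st A st') :
    ∃ σ : Strategy E, σ.radius = ρ₀ ∧ σ.IsLegal β ∧ ∀ x, σ.IsPlay x → ∃ st : ℕ → St,
      (∀ k, Inv k (x k) (st k)) ∧ ∀ k, Step k (st k) (σ.response x (k + 1)) (st (k + 1)) := by
  classical
  choose! next hne hsep hball hupd using hstep
  choose! upd hInv hStep using hupd
  -- the state after Bob has chosen `x 0, …, x k`
  let state : (ℕ → E) → ℕ → St := fun x k =>
    Nat.rec st₀ (fun k st => upd k (x k) st (x (k + 1))) k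
  have hcongr : ∀ (x y : ℕ → E) (k : ℕ), (∀ j ≤ k, x j = y j) → state x k = state y k := by
    intro x y k h
    induction k with
    | zero => rfl
    | succ k ih =>
      change upd k (x k) (state x k) (x (k + 1)) = upd k (y k) (state y k) (y (k + 1))
      rw [ih fun j hj => h j (hj.trans k.le_succ), h k k.le_succ, h (k + 1) le_rfl]
  let extend : ∀ k : ℕ, (Fin k → E) → ℕ → E := fun k u j => if h : j < k then u ⟨j, h⟩ else x₀
  let σ : Strategy E :=
    { radius := ρ₀
      move := fun k u => match k, u with
        | 0, _ => {x₀}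
        | k + 1, u => next k (u (Fin.last k)) (state (extend (k + 1) u) k) }
  have h0 : ∀ x, σ.response x 0 = {x₀} := fun _ => rfl
  have hsucc : ∀ x k, σ.response x (k + 1) = next k (x k) (state x k) := by
    intro x k
    change next k (x k) (state (extend (k + 1) fun i => x i) k) = _
    rw [hcongr _ x k fun j hj => by simp [extend, Nat.lt_succ_of_le hj]]
  have hinv : ∀ (x : ℕ → E) (k : ℕ), (∀ j ≤ k, x j ∈ σ.response x j) →
      Inv k (x k) (state x k) := by
    intro x k hx
    induction k with
    | zero =>
      have : x 0 = x₀ := by simpa [h0] using hx 0 le_rfl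
      rw [this]
      exact h₀
    | succ k ih =>
      have hk := ih fun j hj => hx j (hj.trans k.le_succ)
      refine hInv k (x k) (state x k) hk (x (k + 1)) ?_
      rw [← hsucc]
      exact hx (k + 1) le_rfl
  refine ⟨σ, rfl, ⟨hρ₀, ?_⟩, ?_⟩
  · rintro x (_ | k) hx
    · simp [h0]
    · have hk := hinv x k fun j hj => hx j (Nat.lt_succ_of_le hj)
      rw [hsucc]
      refine ⟨hne k _ _ hk, hsep k _ _ hk, ?_⟩
      intro j hj
      obtain rfl : k = j := by omega
      exact hball k _ _ hk
  · intro x hx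
    refine ⟨state x, fun k => hinv x k fun j _ => hx j, fun k => ?_⟩
    have hk := hinv x k fun j _ => hx j
    rw [hsucc]
    refine hStep k (x k) (state x k) hk (x (k + 1)) ?_
    rw [← hsucc]
    exact hx (k + 1)

/-- How Alice makes sure that the outcome lies in the analytic set `range f`: along the play she
shrinks a subset of the Baire space, bounding one coordinate after the other. By compactness, the
outcome is the image of a limit point of these subsets. -/
theorem exists_tendsto_of_bounded_coordinates {E : Type*} [MetricSpace E] [CompleteSpace E]
    {f : (ℕ → ℕ) → E} (hf : Continuous f) {Y : ℕ → Set (ℕ → ℕ)} (hY : Antitone Y)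
    (hbdd : ∀ i, ∃ b k, ∀ y ∈ Y k, y i ≤ b) {x : ℕ → E} (hx : CauchySeq x) {r : ℕ → ℝ}
    (hr : Tendsto r atTop (𝓝 0)) (hfx : ∀ k, ∃ y ∈ Y k, dist (f y) (x k) ≤ r k) :
    ∃ p ∈ range f, Tendsto x atTop (𝓝 p) := by
  obtain ⟨p, hp⟩ := cauchySeq_tendsto_of_complete hx
  choose y hyY hy using hfx
  choose b k hb using hbdd
  -- a bound for the `i`-th coordinates of all the points `y n`, including the first `k i` of them
  let c : ℕ → ℕ := fun i => b i + ∑ n ∈ Finset.range (k i), y n i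
  have hmem : ∀ n, y n ∈ Set.pi univ fun i => Iic (c i) := by
    intro n i _
    rcases le_or_gt (k i) n with h | h
    · exact (hb i _ (hY h (hyY n))).trans le_self_add
    · exact (Finset.single_le_sum (f := fun n => y n i) (fun _ _ => Nat.zero_le _)
        (Finset.mem_range.mpr h)).trans le_add_self
  obtain ⟨q, -, φ, hφ, hlim⟩ := (isCompact_univ_pi fun i =>
    (finite_Iic (c i)).isCompact).tendsto_subseq hmem
  refine ⟨p, ⟨q, ?_⟩, hp⟩
  have h1 : Tendsto (fun n => f (y (φ n))) atTop (𝓝 (f q)) := (hf.tendsto q).comp hlim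
  have h2 : Tendsto (fun n => dist (f (y (φ n))) (x (φ n))) atTop (𝓝 0) :=
    squeeze_zero (fun _ => dist_nonneg) (fun n => hy (φ n)) (hr.comp hφ.tendsto_atTop)
  have h3 : Tendsto (fun n => dist (f (y (φ n))) (x (φ n))) atTop (𝓝 (dist (f q) p)) :=
    h1.dist (hp.comp hφ.tendsto_atTop)
  exact dist_eq_zero.mp (tendsto_nhds_unique h3 h2)

theorem Strategy.IsPlay.cauchySeq {E : Type*} [MetricSpace E] {σ : Strategy E} {β : ℝ}
    (hσ : σ.IsLegal β) (h1 : β < 1) {x : ℕ → E} (hx : σ.IsPlay x) : CauchySeq x :=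
  cauchySeq_of_le_geometric β ((1 - β) * σ.radius) h1 fun k => by
    rw [dist_comm]
    refine (hx.dist_le hσ k).trans (le_of_eq ?_)
    rw [Strategy.rho]
    ring

open Strategy in
/-- If the number of choices that Bob has had after turn `k` is at least `ρ_k ^ (-s)`, up to a
constant and a factor `L` per turn, then the score is at least `δ < s` for large `k`, provided that
`log L` is small compared to `log (1 / β)`. -/
theorem eventually_le_partialScore {E : Type*} {σ : Strategy E} {β : ℝ} (h0 : 0 < β) (h1 : β < 1)
    (hρ₀ : 0 < σ.radius) {x : ℕ → E} (hx : σ.IsPlay x) {s δ L c : ℝ} (hL : 0 < L) (hc : 0 < c)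
    (hLδ : Real.log L < (s - δ) * -Real.log β) :
    ∀ᶠ k in atTop, c ≤ σ.cardProd (k + 1) x * L ^ k * σ.rho β k ^ s →
      δ ≤ partialScore β (σ.response x) k := by
  set η := (s - δ) * -Real.log β - Real.log L with hη
  have hη0 : 0 < η := sub_pos.mpr hLδ
  have hlog : 0 < -Real.log β := by linarith [Real.log_neg h0 h1]
  filter_upwards [eventually_gt_atTop 0,
    (tendsto_natCast_atTop_atTop.const_mul_atTop hη0).eventually_ge_atTop
      (s * Real.log σ.radius - Real.log c)] with k hk hkη hck
  have hk' : (0 : ℝ) < k := by exact_mod_cast hk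
  have hρ : 0 < σ.rho β k := mul_pos (pow_pos h0 k) hρ₀
  have hQ : 0 < σ.cardProd (k + 1) x :=
    zero_lt_one.trans_le (one_le_cardProd (hx.isPosition _))
  rw [partialScore, ← Finset.sum_div, ← Real.log_prod (fun i _ => by
    exact_mod_cast (Finset.card_pos.mpr ⟨_, hx i⟩).ne'), one_div, inv_mul_eq_div,
    le_div_iff₀ hk', le_div_iff₀ hlog]
  change δ * k * -Real.log β ≤ Real.log (σ.cardProd (k + 1) x)
  have h2 := Real.log_le_log hc hck
  rw [Real.log_mul (mul_pos hQ (pow_pos hL k)).ne' (Real.rpow_pos_of_pos hρ s).ne',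
    Real.log_mul hQ.ne' (pow_pos hL k).ne', Real.log_pow, Real.log_rpow hρ, Strategy.rho,
    Real.log_mul (pow_pos h0 k).ne' hρ₀.ne', Real.log_pow] at h2
  rw [hη] at hkη
  nlinarith

/-! ### Alice wins on sets of large Hausdorff dimension -/

/-- Along the image of a subset `Y` of the Baire space, bounding one more coordinate costs at most
half of the content. This is where the increasing sets lemma is needed. -/
theorem exists_bound_le_two_mul_dyadicContent {d : ℕ} {s : ℝ}
    (f : (ℕ → ℕ) → EuclideanSpace ℝ (Fin d)) (Y : Set (ℕ → ℕ)) (k : ℕ)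
    (hfin : dyadicContent d s (f '' Y) ≠ ∞) :
    ∃ n, dyadicContent d s (f '' Y) ≤ 2 * dyadicContent d s (f '' {y ∈ Y | y k ≤ n}) := by
  by_contra! hcon
  have hne : dyadicContent d s (f '' Y) ≠ 0 := fun h => by
    have := hcon 0
    rw [h] at this
    exact not_lt_zero this
  have hunion : f '' Y = ⋃ n, f '' {y ∈ Y | y k ≤ n} := by
    rw [← image_iUnion]
    congr 1
    ext y
    simp only [mem_iUnion, mem_ofPred_eq]
    exact ⟨fun hy => ⟨y k, hy, le_rfl⟩, fun ⟨_, hy, _⟩ => hy⟩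
  have hle : dyadicContent d s (f '' Y) ≤ dyadicContent d s (f '' Y) / 2 := by
    conv_lhs => rw [hunion]
    refine netContent_iUnion_le (isNet_dyadicCube d)
      (by rintro n m hnm _ ⟨y, ⟨hy, hyn⟩, rfl⟩; exact ⟨y, ⟨hy, hyn.trans hnm⟩, rfl⟩) fun n => ?_
    refine (ENNReal.le_div_iff_mul_le (by simp) (by simp)).mpr ?_
    rw [mul_comm]
    exact (hcon n).le
  exact (ENNReal.half_lt_self hne hfin).not_ge hle

/-- Alice's strategy follows the dyadic content of the part of the set that is still in play. -/
theorem hausdorffWinning_of_lt_dimH {d : ℕ} {S : Set (EuclideanSpace ℝ (Fin d))}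
    (hS : MeasurableSet S) {δ : ℝ≥0} (hδ : (δ : ℝ≥0∞) < dimH S) :
    HausdorffWinning (δ : ℝ) S := by
  obtain ⟨s, hδs, hs⟩ := exists_between hδ
  lift s to ℝ≥0 using hs.ne_top
  have hδs' : (δ : ℝ) < s := by exact_mod_cast hδs
  have hs0 : (0 : ℝ) < s := δ.coe_nonneg.trans_lt hδs'
  have hcont : dyadicContent d s S ≠ 0 := fun h => by
    have h1 := hausdorffMeasure_of_lt_dimH hs
    rw [hausdorffMeasure_eq_zero_of_dyadicContent_eq_zero hs0 h] at h1
    exact ENNReal.zero_ne_top h1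
  obtain ⟨f, hf, rfl⟩ : ∃ f : (ℕ → ℕ) → EuclideanSpace ℝ (Fin d), Continuous f ∧ range f = S := by
    have hA := hS.analyticSet
    rw [AnalyticSet] at hA
    rcases hA with rfl | h
    · exact absurd netContent_empty hcont
    · exact h
  obtain ⟨x₀, hx₀⟩ : ∃ x₀, dyadicContent d s (range f ∩ Metric.closedBall x₀ (1 / 2)) ≠ 0 := by
    by_contra! hcon
    refine hcont ?_
    have hcov : range f = ⋃ n, range f ∩
        Metric.closedBall (TopologicalSpace.denseSeq (EuclideanSpace ℝ (Fin d)) n) (1 / 2) := by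
      rw [← inter_iUnion, inter_eq_self_of_subset_left]
      intro y _
      obtain ⟨n, hn⟩ := (TopologicalSpace.denseRange_denseSeq _).exists_dist_lt y
        (by norm_num : (0 : ℝ) < 1 / 2)
      exact mem_iUnion.mpr ⟨n, hn.le⟩
    rw [hcov]
    exact netContent_iUnion_eq_zero (isNet_dyadicCube d) fun n => hcon _
  obtain ⟨β₁, ⟨hβ₁0, hβ₁1⟩, hβ₁⟩ := exists_forall_lossFactor_lt d (sub_pos.mpr hδs')
  refine ⟨min β₁ (1 / 4), ⟨lt_min hβ₁0 (by norm_num), (min_le_left _ _).trans_lt hβ₁1⟩, ?_⟩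
  rintro β ⟨h0, hβ⟩
  have hββ₁ : β < β₁ := hβ.trans_le (min_le_left _ _)
  have hβ4 : β < 1 / 4 := hβ.trans_le (min_le_right _ _)
  have h1 : β < 1 := by linarith
  set L := lossFactor d β with hL
  have hL1 : 1 ≤ L := one_le_lossFactor d h0 h1
  -- The image of `Y` is what is still in play. It stays in a ball of half the radius, so that for
  -- `β ≤ 1 / 2` all of its points are legal centers in the next turn.
  let Inv : ℕ → EuclideanSpace ℝ (Fin d) → Set (ℕ → ℕ) → Prop := fun k x Y =>
    f '' Y ⊆ Metric.closedBall x (β ^ k * 1 / 2) ∧ dyadicContent d s (f '' Y) ≠ 0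
  let Step : ℕ → Set (ℕ → ℕ) → Finset (EuclideanSpace ℝ (Fin d)) → Set (ℕ → ℕ) → Prop :=
    fun k Y A Y' => Y' ⊆ Y ∧ (∃ n, ∀ y ∈ Y', y k ≤ n) ∧
      (dyadicContent d s (f '' Y)).toReal ≤
        2 * L * (A.card * (dyadicContent d s (f '' Y')).toReal)
  have hle : ∀ k x Y, Inv k x Y →
      dyadicContent d s (f '' Y) ≤ 3 ^ d * ENNReal.ofReal (β ^ k) ^ (s : ℝ) := by
    intro k x Y hY
    have hβk : β ^ k ≤ 1 := pow_le_one₀ h0.le h1.le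
    refine (netContent_mono hY.1).trans ((dyadicContent_closedBall_le d hs0.le x
      (by positivity) (by linarith)).trans (le_of_eq ?_))
    congr 3
    ring
  have htop : ∀ k : ℕ, (3 : ℝ≥0∞) ^ d * ENNReal.ofReal (β ^ k) ^ (s : ℝ) ≠ ∞ := fun k =>
    ENNReal.mul_ne_top (ENNReal.pow_ne_top (by simp))
      (ENNReal.rpow_ne_top_of_nonneg hs0.le ENNReal.ofReal_ne_top)
  obtain ⟨σ, hσρ, hσ, hplay⟩ := exists_strategy_of_states (β := β) one_pos Inv Step
    (x₀ := x₀) (st₀ := f ⁻¹' Metric.closedBall x₀ (1 / 2)) (by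
      refine ⟨?_, ?_⟩
      · rw [pow_zero, one_mul]
        exact image_preimage_subset _ _
      · rwa [image_preimage_eq_range_inter]) (by
    intro k x Y hY
    have hρ : 0 < β ^ k * 1 := by positivity
    have hfin : ∀ U, U ⊆ f '' Y → dyadicContent d s U ≠ ∞ := fun U hU =>
      ne_top_of_le_ne_top (htop k) ((netContent_mono hU).trans (hle k x Y hY))
    have hne : (f '' Y).Nonempty := by
      rw [nonempty_iff_ne_empty]
      intro h
      exact hY.2 (by rw [h]; exact netContent_empty)
    obtain ⟨A, hAne, hAT, hsep, hA⟩ := exists_heavy_separated h0 hβ4.le hρ hne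
      (hY.1.trans (Metric.closedBall_subset_closedBall (by linarith)))
      (φ := fun U => (dyadicContent d s U).toReal)
      (by simp [dyadicContent, netContent_empty])
      (fun U V hUV hV => ENNReal.toReal_mono (hfin V hV) (netContent_mono hUV))
      (fun U V hU hV => by
        rw [← ENNReal.toReal_add (hfin U hU) (hfin V hV)]
        exact ENNReal.toReal_mono (ENNReal.add_ne_top.mpr ⟨hfin U hU, hfin V hV⟩)
          (netContent_union_le U V))
    have hpow : β ^ (k + 1) * 1 = β * (β ^ k * 1) := by ring
    refine ⟨A, hAne, ?_, ?_, ?_⟩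
    · rw [hpow]
      exact hsep
    · intro a ha
      refine Metric.closedBall_subset_closedBall ?_ (hY.1 (hAT ha))
      nlinarith
    · intro a ha
      have hmass := hA a ha
      set B := Metric.closedBall a (β * (β ^ k * 1) / 2) with hB
      have himage : f '' (Y ∩ f ⁻¹' B) = f '' Y ∩ B := image_inter_preimage f Y B
      obtain ⟨n, hn⟩ := exists_bound_le_two_mul_dyadicContent (d := d) (s := s) f (Y ∩ f ⁻¹' B) k
        (by rw [himage]; exact hfin _ inter_subset_left)
      set Y' := {y ∈ Y ∩ f ⁻¹' B | y k ≤ n} with hY'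
      have hY'Y : Y' ⊆ Y := fun y hy => hy.1.1
      have hfinY' := hfin _ (image_mono hY'Y)
      rw [himage] at hn
      have hn' : (dyadicContent d s (f '' Y ∩ B)).toReal ≤
          2 * (dyadicContent d s (f '' Y')).toReal := by
        have := ENNReal.toReal_mono (ENNReal.mul_ne_top (by simp) hfinY') hn
        simpa using this
      have hstep : (dyadicContent d s (f '' Y)).toReal ≤
          2 * L * (A.card * (dyadicContent d s (f '' Y')).toReal) := by
        refine hmass.trans ?_
        calc L * (A.card * (dyadicContent d s (f '' Y ∩ B)).toReal)
            ≤ L * (A.card * (2 * (dyadicContent d s (f '' Y')).toReal)) := by gcongr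
          _ = _ := by ring
      refine ⟨Y', ⟨?_, fun h => ?_⟩, hY'Y, ⟨n, fun y hy => hy.2⟩, hstep⟩
      · rw [hpow]
        exact image_subset_iff.mpr fun y hy => hy.1.2
      · rw [h] at hstep
        simp only [ENNReal.toReal_zero, mul_zero] at hstep
        exact hstep.not_gt (ENNReal.toReal_pos hY.2 (hfin _ subset_rfl)))
  refine ⟨σ, hσ, fun x hx => ?_⟩
  obtain ⟨Y, hInv, hStep⟩ := hplay x hx
  have hρ : ∀ k, σ.rho β k = β ^ k * 1 := fun k => by rw [Strategy.rho, hσρ]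
  constructor
  · refine exists_tendsto_of_bounded_coordinates hf
      (antitone_nat_of_succ_le fun k => (hStep k).1) (fun i => ?_) (hx.cauchySeq hσ h1)
      (σ.tendsto_rho h0 h1) fun k => ?_
    · obtain ⟨b, hb⟩ := (hStep i).2.1
      exact ⟨b, i + 1, hb⟩
    · have hne : (f '' Y k).Nonempty := by
        rw [nonempty_iff_ne_empty]
        intro h
        exact (hInv k).2 (by rw [h]; exact netContent_empty)
      obtain ⟨_, y, hy, rfl⟩ := hne
      refine ⟨y, hy, ((hInv k).1 ⟨y, hy, rfl⟩ : dist _ _ ≤ _).trans ?_⟩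
      rw [hρ]
      have : 0 < β ^ k := pow_pos h0 k
      linarith
  · have hpos : 0 < (dyadicContent d s (f '' Y 0)).toReal :=
      ENNReal.toReal_pos (hInv 0).2 (ne_top_of_le_ne_top (htop 0) (hle 0 _ _ (hInv 0)))
    have hprod : ∀ k, (dyadicContent d s (f '' Y 0)).toReal ≤ σ.cardProd (k + 1) x *
        (2 * L) ^ k * (dyadicContent d s (f '' Y k)).toReal := by
      intro k
      induction k with
      | zero =>
        rw [pow_zero, mul_one]
        exact le_mul_of_one_le_left hpos.le (Strategy.one_le_cardProd (hx.isPosition _))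
      | succ k ih =>
        have hQ := zero_le_one.trans (Strategy.one_le_cardProd (hx.isPosition (k + 1)))
        refine ih.trans ((mul_le_mul_of_nonneg_left (hStep k).2.2 (by positivity)).trans
          (le_of_eq ?_))
        rw [σ.cardProd_succ (k + 1)]
        ring
    refine le_liminf_of_le (by isBoundedDefault) ?_
    filter_upwards [eventually_le_partialScore h0 h1 hσ.1 hx (s := s) (δ := δ)
      (c := (dyadicContent d s (f '' Y 0)).toReal / 3 ^ d) (by positivity : 0 < 2 * L)
      (by positivity) (hβ₁ β ⟨h0, hββ₁⟩)] with k hk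
    refine EReal.coe_le_coe_iff.mpr (hk ?_)
    have hQ := zero_le_one.trans (Strategy.one_le_cardProd (hx.isPosition (k + 1)))
    have h2 := ENNReal.toReal_mono (htop k) (hle k _ _ (hInv k))
    rw [ENNReal.toReal_mul, ENNReal.toReal_pow, ← ENNReal.toReal_rpow,
      ENNReal.toReal_ofReal (pow_nonneg h0.le k)] at h2
    rw [div_le_iff₀ (by positivity), hρ, mul_one]
    refine (hprod k).trans ((mul_le_mul_of_nonneg_left h2 (by positivity)).trans (le_of_eq ?_))
    simp
    ring

/-! ### Alice wins on sets of large packing dimension -/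

/-- A set that is not null for the `s`-dimensional packing measure has arbitrarily fine packings of
large `t`-dimensional mass, for each `t < s`. -/
theorem exists_packing_one_le {X : Type*} [PseudoMetricSpace X] {s t : ℝ≥0} (hts : t < s)
    {E : Set X} (hE : packingMeasure s E ≠ 0) {ε : ℝ} (hε : 0 < ε) :
    ∃ P, IsPacking ε E P ∧ 1 ≤ ∑ p ∈ P, (2 * p.2) ^ (t : ℝ) := by
  have hpre : 0 < packingPremeasure s E :=
    lt_of_lt_of_le (pos_iff_ne_zero.mpr hE) (OuterMeasure.ofFunction_le E)
  obtain ⟨c, hc0, hc⟩ := ENNReal.lt_iff_exists_nnreal_btwn.mp hpre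
  have hc0' : (0 : ℝ) < c := by exact_mod_cast hc0
  have hst : (0 : ℝ) < s - t := sub_pos.mpr (by exact_mod_cast hts)
  set ε' := min ε ((c : ℝ) ^ ((s : ℝ) - t)⁻¹ / 2) with hε'
  have hε'0 : 0 < ε' := lt_min hε (half_pos (Real.rpow_pos_of_pos hc0' _))
  have hle : (2 * ε') ^ ((s : ℝ) - t) ≤ c := by
    have h2 : 2 * ε' ≤ (c : ℝ) ^ ((s : ℝ) - t)⁻¹ := by
      linarith [min_le_right ε ((c : ℝ) ^ ((s : ℝ) - t)⁻¹ / 2)]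
    exact (Real.rpow_le_rpow (by positivity) h2 hst.le).trans_eq
      (Real.rpow_inv_rpow hc0'.le hst.ne')
  have hsup := hc.trans_le (iInf₂_le ε' hε'0)
  simp only [packingSup, lt_iSup_iff] at hsup
  obtain ⟨P, hP, hsum⟩ := hsup
  refine ⟨P, ⟨hP.center_mem, hP.radius_pos, fun p hp =>
    (hP.radius_le p hp).trans (min_le_left _ _), hP.pairwise_disjoint⟩, ?_⟩
  have hpos : ∀ p ∈ P, 0 < 2 * p.2 := fun p hp => by linarith [hP.radius_pos p hp]
  have h1 : (c : ℝ) < ∑ p ∈ P, (2 * p.2) ^ (s : ℝ) := by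
    rw [Finset.sum_congr rfl fun p hp => ENNReal.ofReal_rpow_of_pos (hpos p hp),
      ← ENNReal.ofReal_sum_of_nonneg fun p hp => Real.rpow_nonneg (hpos p hp).le _,
      ← ENNReal.ofReal_coe_nnreal] at hsum
    exact lt_of_not_ge fun h => hsum.not_ge (ENNReal.ofReal_le_ofReal h)
  have h2 : ∑ p ∈ P, (2 * p.2) ^ (s : ℝ) ≤ c * ∑ p ∈ P, (2 * p.2) ^ (t : ℝ) := by
    rw [Finset.mul_sum]
    refine Finset.sum_le_sum fun p hp => ?_
    have : (2 * p.2) ^ (s : ℝ) = (2 * p.2) ^ ((s : ℝ) - t) * (2 * p.2) ^ (t : ℝ) := by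
      rw [← Real.rpow_add (hpos p hp), sub_add_cancel]
    rw [this]
    refine mul_le_mul_of_nonneg_right (le_trans ?_ hle) (Real.rpow_nonneg (hpos p hp).le _)
    exact Real.rpow_le_rpow (hpos p hp).le (by linarith [hP.radius_le p hp]) hst.le
  by_contra! h
  nlinarith

/-- Points having a null neighborhood can be discarded from a set that is not null. -/
theorem outerMeasure_inter_support_ne_zero {X : Type*} [TopologicalSpace X]
    [SecondCountableTopology X] (ν : OuterMeasure X) {U : Set X} (hU : ν U ≠ 0) :
    ν (U ∩ {y | ∀ V ∈ 𝓝 y, ν V ≠ 0}) ≠ 0 := by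
  intro h
  have hnull : ν (U \ {y | ∀ V ∈ 𝓝 y, ν V ≠ 0}) = 0 := by
    refine measure_null_of_locally_null _ fun y hy => ?_
    obtain ⟨V, hV, hν⟩ : ∃ V ∈ 𝓝 y, ν V = 0 := by
      by_contra! hcon
      exact hy.2 hcon
    exact ⟨V, mem_nhdsWithin_of_mem_nhds hV, hν⟩
  have hle := measure_le_inter_add_sdiff ν U {y | ∀ V ∈ 𝓝 y, ν V ≠ 0}
  rw [h, hnull, add_zero] at hle
  exact hU (le_antisymm hle zero_le)

/-- Alice follows the mass of a fine packing of the part of the set that is still in play until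
Bob has moved so close to the center of one of its balls that only this ball is left. At that time
her score is large, and she passes to a much finer packing near this center. -/
theorem packingWinning_of_lt_dimP {d : ℕ} {S : Set (EuclideanSpace ℝ (Fin d))}
    (hS : MeasurableSet S) {δ : ℝ≥0} (hδ : (δ : ℝ≥0∞) < dimP S) :
    PackingWinning (δ : ℝ) S := by
  classical
  simp only [dimP, lt_iSup_iff] at hδ
  obtain ⟨s, hsS, hδs⟩ := hδ
  obtain ⟨t, hδt, hts⟩ := exists_between (ENNReal.coe_lt_coe.mp hδs)
  have hδt' : (δ : ℝ) < t := by exact_mod_cast hδt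
  obtain ⟨f, hf, rfl⟩ : ∃ f : (ℕ → ℕ) → EuclideanSpace ℝ (Fin d), Continuous f ∧ range f = S := by
    have hA := hS.analyticSet
    rw [AnalyticSet] at hA
    rcases hA with rfl | h
    · simp at hsS
    · exact h
  let ν : OuterMeasure (ℕ → ℕ) := OuterMeasure.comap f (packingMeasure s)
  let K : Set (ℕ → ℕ) := {y | ∀ V ∈ 𝓝 y, ν V ≠ 0}
  let mass : Finset (EuclideanSpace ℝ (Fin d) × ℝ) → ℝ := fun P => ∑ p ∈ P, (2 * p.2) ^ (t : ℝ)
  have hfresh : ∀ y ∈ K, ∀ U ∈ 𝓝 y, ∀ ε : ℝ, 0 < ε →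
      ∃ P, IsPacking ε (f '' (U ∩ K)) P ∧ 1 ≤ mass P := fun y hy U hU ε hε =>
    exists_packing_one_le hts (outerMeasure_inter_support_ne_zero ν (hy U hU)) hε
  have hmass_ne : ∀ P, 1 ≤ mass P → P.Nonempty := fun P hP => by
    rw [Finset.nonempty_iff_ne_empty]
    rintro rfl
    simp only [mass, Finset.sum_empty] at hP
    linarith
  obtain ⟨y₀, -, hy₀⟩ : (univ ∩ K).Nonempty := by
    rw [nonempty_iff_ne_empty]
    intro h
    refine outerMeasure_inter_support_ne_zero ν (U := univ) ?_
      ((congrArg ν h).trans (measure_empty (μ := ν)))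
    simp [ν, hsS]
  obtain ⟨β₁, ⟨hβ₁0, hβ₁1⟩, hβ₁⟩ := exists_forall_lossFactor_lt d (sub_pos.mpr hδt')
  refine ⟨min β₁ (1 / 4), ⟨lt_min hβ₁0 (by norm_num), (min_le_left _ _).trans_lt hβ₁1⟩, ?_⟩
  rintro β ⟨h0, hβ⟩
  have hββ₁ : β < β₁ := hβ.trans_le (min_le_left _ _)
  have hβ4 : β < 1 / 4 := hβ.trans_le (min_le_right _ _)
  have h1 : β < 1 := by linarith
  set L := lossFactor d β with hL
  have hL1 : 1 ≤ L := one_le_lossFactor d h0 h1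
  -- The radius factor `3 / 4` leaves room for new packings, which need not stay in the ball of half
  -- the radius that contains the old one; for `β ≤ 1 / 4` all the centers are still legal.
  let Inv : ℕ → EuclideanSpace ℝ (Fin d) →
      Set (ℕ → ℕ) × Finset (EuclideanSpace ℝ (Fin d) × ℝ) → Prop := fun k x st =>
    IsOpen st.1 ∧ st.2.Nonempty ∧ (k = 0 → 1 ≤ mass st.2) ∧
      IsPacking (2 * (β ^ k * 1))
        (f '' (st.1 ∩ K) ∩ Metric.closedBall x (3 / 4 * (β ^ k * 1))) st.2
  -- Either Alice keeps the part of the packing within reach, or she passes to a new packing.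
  let Renew : ℕ → Set (ℕ → ℕ) × Finset (EuclideanSpace ℝ (Fin d) × ℝ) →
      Finset (EuclideanSpace ℝ (Fin d)) →
      Set (ℕ → ℕ) × Finset (EuclideanSpace ℝ (Fin d) × ℝ) → Prop := fun k st A st' =>
    mass st.2 ≤ L * (A.card * (4 * (β ^ k * 1)) ^ (t : ℝ)) ∧ 1 ≤ mass st'.2 ∧
      ∃ y₁ : ℕ → ℕ, ∀ y ∈ st'.1, ∀ i < k + 1, y i = y₁ i
  let Step : ℕ → Set (ℕ → ℕ) × Finset (EuclideanSpace ℝ (Fin d) × ℝ) →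
      Finset (EuclideanSpace ℝ (Fin d)) →
      Set (ℕ → ℕ) × Finset (EuclideanSpace ℝ (Fin d) × ℝ) → Prop := fun k st A st' =>
    st'.1 ⊆ st.1 ∧ ((st'.2 ⊆ st.2 ∧ mass st.2 ≤ L * (A.card * mass st'.2)) ∨ Renew k st A st')
  have hball : ∀ (y : ℕ → ℕ) (r : ℝ), 0 < r → f ⁻¹' Metric.ball (f y) r ∈ 𝓝 y := fun y r hr =>
    hf.continuousAt.preimage_mem_nhds (Metric.ball_mem_nhds _ hr)
  obtain ⟨P₀, hP₀, hP₀m⟩ := hfresh y₀ hy₀ _ (hball y₀ (3 / 4) (by norm_num)) 2 (by norm_num)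
  obtain ⟨σ, hσρ, hσ, hplay⟩ := exists_strategy_of_states (β := β) one_pos Inv Step
    (x₀ := f y₀) (st₀ := (f ⁻¹' Metric.ball (f y₀) (3 / 4), P₀))
    ⟨Metric.isOpen_ball.preimage hf, hmass_ne _ hP₀m, fun _ => hP₀m, by
      refine ⟨fun p hp => ?_, hP₀.radius_pos, fun p hp => ?_, hP₀.pairwise_disjoint⟩
      · obtain ⟨y, hy, hyp⟩ := hP₀.center_mem p hp
        refine ⟨⟨y, hy, hyp⟩, ?_⟩
        rw [← hyp, pow_zero, one_mul, mul_one]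
        exact Metric.ball_subset_closedBall hy.1
      · rw [pow_zero, one_mul, mul_one]
        exact hP₀.radius_le p hp⟩ (by
    rintro k x ⟨Y, P⟩ ⟨hY, hPne, -, hP⟩
    have hρ : 0 < β ^ k * 1 := by positivity
    have hpow : β ^ (k + 1) * 1 = β * (β ^ k * 1) := by ring
    have hterm : ∀ p ∈ P, 0 ≤ (2 * p.2) ^ (t : ℝ) := fun p hp =>
      Real.rpow_nonneg (by linarith [hP.radius_pos p hp]) _
    set T : Set (EuclideanSpace ℝ (Fin d)) :=
      Prod.fst '' (P : Set (EuclideanSpace ℝ (Fin d) × ℝ)) with hT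
    have hTx : T ⊆ Metric.closedBall x (3 / 4 * (β ^ k * 1)) := by
      rintro _ ⟨p, hp, rfl⟩
      exact (hP.center_mem p hp).2
    let φ : Set (EuclideanSpace ℝ (Fin d)) → ℝ := fun U =>
      ∑ p ∈ P, if p.1 ∈ U then (2 * p.2) ^ (t : ℝ) else 0
    obtain ⟨A, hAne, hAT, hsep, hA⟩ := exists_heavy_separated h0 hβ4.le hρ
      ((Finset.coe_nonempty.mpr hPne).image Prod.fst)
      (hTx.trans (Metric.closedBall_subset_closedBall (by linarith))) (φ := φ) (by simp [φ])
      (fun U V hUV _ => Finset.sum_le_sum fun p hp => by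
        have := hterm p hp
        split_ifs with h h'
        exacts [le_rfl, absurd (hUV h) h', this, le_rfl])
      (fun U V _ _ => by
        rw [← Finset.sum_add_distrib]
        refine Finset.sum_le_sum fun p hp => ?_
        have := hterm p hp
        by_cases hU : p.1 ∈ U <;> by_cases hV : p.1 ∈ V <;> simp [hU, hV, this])
    refine ⟨A, hAne, ?_, ?_, fun a ha => ?_⟩
    · rw [hpow]
      exact hsep
    · intro a ha
      refine Metric.closedBall_subset_closedBall ?_ (hTx (hAT ha))
      nlinarith
    set P' := P.filter fun p => p.1 ∈ Metric.closedBall a (β * (β ^ k * 1) / 2) with hP'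
    have hP'P : P' ⊆ P := Finset.filter_subset _ _
    have hmem : ∀ p ∈ P, p.1 ∈ T := fun p hp => ⟨p, hp, rfl⟩
    have hmass : mass P ≤ L * (A.card * mass P') := by
      have h := hA a ha
      have e1 : φ T = mass P := Finset.sum_congr rfl fun p hp => if_pos (hmem p hp)
      have e2 : φ (T ∩ Metric.closedBall a (β * (β ^ k * 1) / 2)) = mass P' := by
        simp only [φ, mass, hP', Finset.sum_filter]
        refine Finset.sum_congr rfl fun p hp => ?_
        simp only [mem_inter_iff, hmem p hp, true_and]
      rwa [e1, e2] at h
    have hP'ne : P'.Nonempty := by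
      obtain ⟨p, hp, rfl⟩ := hAT ha
      exact ⟨p, Finset.mem_filter.mpr ⟨hp, Metric.mem_closedBall_self (by positivity)⟩⟩
    by_cases hsmall : ∀ p ∈ P', p.2 ≤ 2 * (β ^ (k + 1) * 1)
    · refine ⟨(Y, P'), ⟨hY, hP'ne, fun h => absurd h k.succ_ne_zero, fun p hp => ?_,
        fun p hp => hP.radius_pos p (hP'P hp), hsmall, fun p hp q hq =>
          hP.pairwise_disjoint p (hP'P hp) q (hP'P hq)⟩, subset_rfl, Or.inl ⟨hP'P, hmass⟩⟩
      refine ⟨(hP.center_mem p (hP'P hp)).1,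
        Metric.closedBall_subset_closedBall ?_ (Finset.mem_filter.mp hp).2⟩
      rw [hpow]
      have := mul_pos h0 hρ
      linarith
    · -- a ball with large radius contains the centers of all the other balls within reach
      push Not at hsmall
      obtain ⟨p, hp, hpr⟩ := hsmall
      have hsingle : P' = {p} := by
        refine Finset.eq_singleton_iff_unique_mem.mpr ⟨hp, fun q hq => ?_⟩
        by_contra hqp
        have hdisj := hP.pairwise_disjoint p (hP'P hp) q (hP'P hq) (Ne.symm hqp)
        have hd := dist_triangle_right q.1 p.1 a
        have hda : dist q.1 a ≤ _ := (Finset.mem_filter.mp hq).2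
        have hdp : dist p.1 a ≤ _ := (Finset.mem_filter.mp hp).2
        rw [hpow] at hpr
        have := mul_pos h0 hρ
        have hqp' : dist q.1 p.1 ≤ p.2 := by linarith
        exact Set.disjoint_left.mp hdisj hqp'
          (Metric.mem_closedBall_self (hP.radius_pos q (hP'P hq)).le)
      obtain ⟨⟨y₁, ⟨hy₁Y, hy₁K⟩, hy₁p⟩, -⟩ := hP.center_mem p (hP'P hp)
      have hρ' : 0 < β ^ (k + 1) * 1 := by positivity
      set Y' : Set (ℕ → ℕ) := Y ∩ (PiNat.cylinder y₁ (k + 1) ∩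
        f ⁻¹' Metric.ball (f y₁) (1 / 4 * (β ^ (k + 1) * 1))) with hY'
      have hY'o : IsOpen Y' := hY.inter ((PiNat.isOpen_cylinder _ _ _).inter
        (Metric.isOpen_ball.preimage hf))
      have hy₁' : y₁ ∈ Y' := ⟨hy₁Y, PiNat.self_mem_cylinder _ _,
        Metric.mem_ball_self (by positivity)⟩
      obtain ⟨Q, hQ, hQm⟩ := hfresh y₁ hy₁K Y' (hY'o.mem_nhds hy₁') (2 * (β ^ (k + 1) * 1))
        (by positivity)
      refine ⟨(Y', Q), ⟨hY'o, hmass_ne _ hQm, fun h => absurd h k.succ_ne_zero, fun q hq => ?_,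
        hQ.radius_pos, hQ.radius_le, hQ.pairwise_disjoint⟩, inter_subset_left, Or.inr
          ⟨hmass.trans ?_, hQm, y₁, fun y hy i hi => hy.2.1 i hi⟩⟩
      · obtain ⟨y, hy, hyq⟩ := hQ.center_mem q hq
        refine ⟨⟨y, hy, hyq⟩, ?_⟩
        have hd1 : dist (f y) (f y₁) < _ := hy.1.2.2
        have hd2 : dist p.1 a ≤ _ := (Finset.mem_filter.mp hp).2
        rw [hy₁p, hyq] at hd1
        rw [← hpow] at hd2
        have := dist_triangle q.1 p.1 a
        exact (show dist q.1 a ≤ _ by linarith)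
      · have hr := hP.radius_le p (hP'P hp)
        have hr0 := hP.radius_pos p (hP'P hp)
        have : mass P' ≤ (4 * (β ^ k * 1)) ^ (t : ℝ) := by
          rw [hsingle]
          simp only [mass, Finset.sum_singleton]
          exact Real.rpow_le_rpow (by linarith) (by linarith) t.coe_nonneg
        gcongr)
  refine ⟨σ, hσ, fun x hx => ?_⟩
  obtain ⟨st, hInv, hStep⟩ := hplay x hx
  have hρ : ∀ k, σ.rho β k = β ^ k * 1 := fun k => by rw [Strategy.rho, hσρ]
  have hrenew : ∀ N, ∃ k ≥ N, Renew k (st k) (σ.response x (k + 1)) (st (k + 1)) := by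
    intro N
    by_contra! hcon
    have hsub : ∀ k ≥ N, (st k).2 ⊆ (st N).2 := by
      intro k hk
      induction k, hk using Nat.le_induction with
      | base => exact subset_rfl
      | succ k hk ih => exact ((hStep k).2.resolve_right (hcon k hk)).1.trans ih
    obtain ⟨p, hp, hmin⟩ := Finset.exists_min_image (st N).2 Prod.snd (hInv N).2.1
    have hle : ∀ k ≥ N, p.2 ≤ 2 * σ.rho β k := by
      intro k hk
      obtain ⟨q, hq⟩ := (hInv k).2.1
      rw [hρ]
      exact (hmin q (hsub k hk hq)).trans ((hInv k).2.2.2.radius_le q hq)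
    have hlim := (σ.tendsto_rho h0 h1).const_mul 2
    rw [mul_zero] at hlim
    exact ((hInv N).2.2.2.radius_pos p hp).not_ge
      (ge_of_tendsto hlim (eventually_atTop.mpr ⟨N, hle⟩))
  constructor
  · refine exists_tendsto_of_bounded_coordinates hf (Y := fun k => (st k).1)
      (antitone_nat_of_succ_le fun k => (hStep k).1) (fun i => ?_) (hx.cauchySeq hσ h1)
      (σ.tendsto_rho h0 h1) fun k => ?_
    · obtain ⟨k, hk, -, -, y₁, hy₁⟩ := hrenew i
      exact ⟨y₁ i, k + 1, fun y hy => (hy₁ y hy i (Nat.lt_succ_of_le hk)).le⟩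
    · obtain ⟨p, hp⟩ := (hInv k).2.1
      obtain ⟨⟨y, hy, hyp⟩, hpx⟩ := (hInv k).2.2.2.center_mem p hp
      refine ⟨y, hy.1, ?_⟩
      rw [hyp, hρ]
      have h2 : dist p.1 (x k) ≤ _ := hpx
      have : 0 < β ^ k := pow_pos h0 k
      linarith
  · have hQ : ∀ k, 0 < σ.cardProd k x := fun k =>
      zero_lt_one.trans_le (Strategy.one_le_cardProd (hx.isPosition k))
    have hprod : ∀ k, 1 ≤ σ.cardProd (k + 1) x * L ^ k * mass (st k).2 := by
      intro k
      induction k with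
      | zero =>
        rw [pow_zero, mul_one]
        exact one_le_mul_of_one_le_of_one_le (Strategy.one_le_cardProd (hx.isPosition _))
          ((hInv 0).2.2.1 rfl)
      | succ k ih =>
        rcases (hStep k).2 with ⟨-, h⟩ | ⟨-, h, -⟩
        · refine ih.trans ((mul_le_mul_of_nonneg_left h
            (mul_pos (hQ _) (by positivity)).le).trans (le_of_eq ?_))
          rw [σ.cardProd_succ (k + 1)]
          ring
        · exact one_le_mul_of_one_le_of_one_le (one_le_mul_of_one_le_of_one_le
            (Strategy.one_le_cardProd (hx.isPosition _)) (one_le_pow₀ hL1)) h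
    have hlog : Real.log L < ((t : ℝ) - δ) * -Real.log β :=
      (Real.log_le_log (by linarith) (by linarith)).trans_lt (hβ₁ β ⟨h0, hββ₁⟩)
    have hfreq : ∃ᶠ k in atTop, (β / 4) ^ (t : ℝ) ≤
        σ.cardProd (k + 1) x * L ^ k * σ.rho β k ^ (t : ℝ) := by
      refine frequently_atTop.mpr fun N => ?_
      obtain ⟨k, hk, h, -, -⟩ := hrenew N
      refine ⟨k + 1, by omega, ?_⟩
      have hk0 : 0 < β ^ k * 1 := by positivity
      have h2 := (hprod k).trans (mul_le_mul_of_nonneg_left h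
        (mul_pos (hQ _) (by positivity)).le)
      have h3 : σ.rho β (k + 1) ^ (t : ℝ) = (β / 4) ^ (t : ℝ) * (4 * (β ^ k * 1)) ^ (t : ℝ) := by
        rw [← Real.mul_rpow (by positivity) (by positivity), hρ]
        congr 1
        ring
      have h4 : 0 < (β / 4) ^ (t : ℝ) := Real.rpow_pos_of_pos (by positivity) _
      rw [h3, σ.cardProd_succ (k + 1)]
      calc (β / 4) ^ (t : ℝ) = (β / 4) ^ (t : ℝ) * 1 := (mul_one _).symm
        _ ≤ _ := mul_le_mul_of_nonneg_left h2 h4.le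
        _ = _ := by ring
    refine le_limsup_of_frequently_le ?_ (by isBoundedDefault)
    refine (hfreq.and_eventually (eventually_le_partialScore h0 h1 hσ.1 hx (s := t) (δ := δ)
      (c := (β / 4) ^ (t : ℝ)) (by linarith : 0 < L) (by positivity) hlog)).mono fun k hk => ?_
    exact EReal.coe_le_coe_iff.mpr (hk.2 hk.1)

end DimensionGame

theorem theorem3p2 (d : ℕ) (S : Set (EuclideanSpace ℝ (Fin d))) (hS : MeasurableSet S) :
    (dimH S = ⨆ (δ : ℝ≥0) (_ : DimensionGame.HausdorffWinning (δ : ℝ) S), (δ : ℝ≥0∞)) ∧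
    (DimensionGame.dimP S =
      ⨆ (δ : ℝ≥0) (_ : DimensionGame.PackingWinning (δ : ℝ) S), (δ : ℝ≥0∞)) := by
  refine ⟨le_antisymm ?_ ?_, le_antisymm ?_ ?_⟩
  · exact ENNReal.le_of_forall_nnreal_lt fun δ hδ =>
      le_iSup₂_of_le δ (DimensionGame.hausdorffWinning_of_lt_dimH hS hδ) le_rfl
  · refine iSup₂_le fun δ ⟨β₀, ⟨h0, h1⟩, h⟩ => ?_
    have hβ : β₀ / 2 ∈ Ioo 0 β₀ := ⟨half_pos h0, half_lt_self h0⟩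
    exact DimensionGame.le_dimH_of_hausdorffWinningWith ⟨hβ.1, hβ.2.trans h1⟩ (h _ hβ)
  · exact ENNReal.le_of_forall_nnreal_lt fun δ hδ =>
      le_iSup₂_of_le δ (DimensionGame.packingWinning_of_lt_dimP hS hδ) le_rfl
  · refine iSup₂_le fun δ ⟨β₀, ⟨h0, h1⟩, h⟩ => ?_
    have hβ : β₀ / 2 ∈ Ioo 0 β₀ := ⟨half_pos h0, half_lt_self h0⟩
    exact DimensionGame.le_dimP_of_packingWinningWith ⟨hβ.1, hβ.2.trans h1⟩ (h _ hβ)
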